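/- Fix real numbers $p>1$, $q>1$ and $T>1$. For each $n$ let $B=B_n$ and $d=d_n$ be natural numbers equal to $n^p$ and $n^T$ up to rounding ($|B_n-n^p|\le 1$, $|d_n-n^T|\le 1$). Let $\phi(x)\in\mathbb R^B$ consist of the first $B$ functions of the Fourier basis $\tfrac1{\sqrt2},\sin(\pi x),\cos(\pi x),\sin(2\pi x),\cos(2\pi x),\dots$, and let $\Sigma=\mathrm{diag}(\lambda_1,\dots,\lambda_B)$ with $\gamma=n^{-q}$, $\lambda_1=\gamma B$ and $\lambda_j=\frac{(1-\gamma)B}{B-1}$ for $j\ge 2$. The training points are $x_i=-1+2i/n$, $i=1,\dots,n$, and all labels are $1$ (the true function is $f^*\equiv 1$). Fourier interpolator: $\widehat f_n(x)=\langle\widehat\alpha,\phi(x)\rangle$, where $\widehat\alpha$ minimizes $\|\Sigma^{-1/2}\alpha\|_2$ over the $\alpha\in\mathbb R^B$ with $\langle\alpha,\phi(x_i)\rangle=1$ for all $i$. Random-Fourier-sum (RFS) interpolator: for each $n$ let $z_1,\dots,z_d$ be i.i.d. $\mathcal N(0,\Sigma)$ vectors in $\mathbb R^B$ (with an arbitrary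 joint law across different $n$, on one probability space), let $\phi^{\mathsf{RFS}}(x)=(\langle z_i,\phi(x)\rangle)_{i\le d}\in\mathbb R^d$, and let $\widehat g_n(x)=\langle\widehat\beta,\phi^{\mathsf{RFS}}(x)\rangle$, where $\widehat\beta$ minimizes $\|\beta\|_2$ over the $\beta\in\mathbb R^d$ with $\langle\beta,\phi^{\mathsf{RFS}}(x_i)\rangle=1$ for all $i$. For $f:\mathbb R\to\mathbb R$ and $x\sim\mathrm{Unif}[-1,1]$ put $$\mathcal C(f)=\mathbb P[\mathrm{sgn} f(x)\ne \mathrm{sgn} f^*(x)],\qquad \mathcal C_{\mathrm{adv}}(f,\varepsilon)=\mathbb E\Big[\max_{|\tilde x-x|\le\varepsilon}\mathbb 1[\mathrm{sgn} f(\tilde x)\ne\mathrm{sgn} f^*(x)]\Big].$$ Then, for all large $n$, the minimizer $\widehat\alpha$ exists and is unique, and almost surely, for all large $n$, so does and is $\widehat\beta$. Moreover: 1. If $T>6p-1$, then $\lim_{n\to\infty}\mathcal C(\widehat f_n)$ exists, and almost surely $\lim_{n\to\infty}\mathcal C(\widehat g_n)$ exists and has the same value. 2. If $T>6p+1-2q$,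 then $\lim_{n\to\infty}\mathcal C_{\mathrm{adv}}(\widehat f_n,\tfrac1n)$ exists, and almost surely $\lim_{n\to\infty}\mathcal C_{\mathrm{adv}}(\widehat g_n,\tfrac1n)$ exists and has the same value. -/

import Mathlib

open MeasureTheory ProbabilityTheory Filter Topology

noncomputable section

namespace RFS

/-- The regularly spaced training points `-1 + 2 i / n`, `i = 1, …, n`. -/
def trainPoint (n : ℕ) (i : Fin n) : ℝ := -1 + 2 * ((i : ℝ) + 1) / n

/-- The constant function `1` that generates all labels. -/
def fstar : ℝ → ℝ := fun _ => 1

/-- The first `B` elements of the Fourier basis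
`1/√2, sin (π x), cos (π x), sin (2 π x), cos (2 π x), …`
(indices start from `0`: index `2k - 1` is `sin (k π x)` and index `2k` is `cos (k π x)`). -/
def fourierFeature (B : ℕ) (x : ℝ) : EuclideanSpace ℝ (Fin B) :=
  WithLp.toLp 2 fun j =>
    if (j : ℕ) = 0 then 1 / Real.sqrt 2
    else if (j : ℕ) % 2 = 1 then Real.sin ((((j : ℕ) + 1) / 2 : ℕ) * Real.pi * x)
    else Real.cos (((j : ℕ) / 2 : ℕ) * Real.pi * x)

/-- The bi-level weights: with `γ = n ^ (-q)`, the constant feature has weight `γ B` and every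
other feature has weight `(1 - γ) B / (B - 1)`. -/
def bilevelWeight (n B : ℕ) (q : ℝ) (j : Fin B) : ℝ :=
  if (j : ℕ) = 0 then (n : ℝ) ^ (-q) * B
  else (1 - (n : ℝ) ^ (-q)) * B / ((B : ℝ) - 1)

/-- The diagonal bi-level weighting matrix `Σ`. -/
def bilevelSigma (n B : ℕ) (q : ℝ) : Matrix (Fin B) (Fin B) ℝ :=
  Matrix.diagonal (bilevelWeight n B q)

/-- The objective `‖Σ^(-1/2) α‖₂` of the weighted minimum-norm problem. -/
def weightedNorm (n B : ℕ) (q : ℝ) (α : EuclideanSpace ℝ (Fin B)) : ℝ :=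
  ‖(WithLp.toLp 2 fun j => (bilevelWeight n B q j) ^ (-(1 / 2) : ℝ) * α j :
    EuclideanSpace ℝ (Fin B))‖

/-- A feature map `Φ` with coefficients `c` interpolates the `n` training labels. -/
def Interpolates {D : ℕ} (n : ℕ) (Φ : ℝ → EuclideanSpace ℝ (Fin D))
    (c : EuclideanSpace ℝ (Fin D)) : Prop :=
  ∀ i : Fin n, inner ℝ c (Φ (trainPoint n i)) = fstar (trainPoint n i)

/-- `c` minimizes the objective `J` among the coefficient vectors that interpolate the training
data on the features `Φ`. -/
def IsMinInterpolator {D : ℕ} (n : ℕ) (Φ : ℝ → EuclideanSpace ℝ (Fin D))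
    (J : EuclideanSpace ℝ (Fin D) → ℝ) (c : EuclideanSpace ℝ (Fin D)) : Prop :=
  Interpolates n Φ c ∧ ∀ c', Interpolates n Φ c' → J c ≤ J c'

open Classical in
/-- The `argmin` of `J` over the interpolating coefficient vectors
(and `0` if there is no minimizer). -/
def minInterpolator {D : ℕ} (n : ℕ) (Φ : ℝ → EuclideanSpace ℝ (Fin D))
    (J : EuclideanSpace ℝ (Fin D) → ℝ) : EuclideanSpace ℝ (Fin D) :=
  if h : ∃ c, IsMinInterpolator n Φ J c then h.choose else 0

/-- The random-Fourier-sum features with weight vectors `z i`. -/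
def rfsFeature {B d : ℕ} (z : Fin d → EuclideanSpace ℝ (Fin B)) (x : ℝ) :
    EuclideanSpace ℝ (Fin d) :=
  WithLp.toLp 2 fun i => inner ℝ (z i) (fourierFeature B x)

/-- The function learned on the Fourier features. -/
def fourierFit (n B : ℕ) (q : ℝ) (x : ℝ) : ℝ :=
  inner ℝ (minInterpolator n (fourierFeature B) (weightedNorm n B q)) (fourierFeature B x)

/-- The function learned on the random-Fourier-sum features with weight vectors `z i`. -/
def rfsFit {B d : ℕ} (n : ℕ) (z : Fin d → EuclideanSpace ℝ (Fin B)) (x : ℝ) : ℝ :=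
  inner ℝ (minInterpolator n (rfsFeature z) (fun β => ‖β‖)) (rfsFeature z x)

/-- The uniform distribution on `[-1, 1]`. -/
def unif : Measure ℝ := ProbabilityTheory.cond volume (Set.Icc (-1 : ℝ) 1)

/-- The classification risk. -/
def classRisk (f : ℝ → ℝ) : ℝ :=
  unif.real {x | SignType.sign (f x) ≠ SignType.sign (fstar x)}

/-- The adversarial classification risk at radius `ε`: the expectation of the maximum, over the
perturbed points `x'` with `|x' - x| ≤ ε`, of the indicator of misclassification. -/
def advRisk (f : ℝ → ℝ) (ε : ℝ) : ℝ :=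
  ∫ x, (⨆ x' : {x' : ℝ // |x' - x| ≤ ε},
    Set.indicator {t : ℝ | SignType.sign (f t) ≠ SignType.sign (fstar x)}
      (fun _ => (1 : ℝ)) (x' : ℝ)) ∂unif

end RFS

end

/-! Write `m` for the mean training feature, `φ` for the Fourier features, `Z` for the matrix with
rows `z i`, and `M = ⌊(B-1)/(2n)⌋`. On the regular grid only the frequencies divisible by `n` have
nonzero mean. Hence the `Σ`-product of `m` with `φ(x)` is a small constant plus `oscWeight` times
the Dirichlet-type kernel `cosSum M` at `nπ(x+1)`, and at every training point it has the same value
`κ = meanWeight`. So `Σm/κ` interpolates, and since `m` lies in the span of the training features it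
is the weighted minimizer; the Fourier fit is explicit (`fourier_interpolation`, `fourierFit_eq`).

For random features let `r` be the part of `Zm` orthogonal to the centered columns `Z(φ(x_j) - m)`.
The minimum-norm interpolator is `r/‖r‖²` (`rfs_interpolation`). Split `φ(x) = ∑ a_j φ(x_j) + y`
with `y` `Σ`-orthogonal to the training features: the two fits at `x` differ by `⟨r, Zy⟩/‖r‖²`,
where `Zy` is independent of `r`. Given `r` this is a centered Gaussian of variance at most
`B/‖r‖²`, and `‖r‖² > dκ/8` except with probability `exp(-d/16)`. As `κ` is of order `n^(p-1)`, a
deviation `t` has probability at most of order `exp(-C t² n^(T-1))` on that event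
(`prob_lt_abs_fit_sub_fit`). Borel–Cantelli turns such bounds into almost sure statements, whatever
the dependence across `n`.

Classification risk: at level `t = n^(-p)` the fits agree up to `t` outside a set of measure `1/n`,
and `tκ → 0`. Sublevel sets of the Fourier fit are `sin((2M+1)v) ≤ b sin v` with `b` depending on
the level only through `tκ`; the fast phase equidistributes, so all levels with `tκ → 0` share one
limit (`exists_tendsto_unif_fourierFit_le`), which sandwiches the random risk.

Adversarial risk: both limits are `1`. In each period, of length `2/n`, the kernel has a deep
negative point, so every `x` has one within `1/n`, where the Fourier fit is at most `-1/10`. Only `n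
+ 2` such points matter, and a union bound keeps the random fit negative at all of them. -/

namespace RFS

open Matrix

/-! ### Gaussian columns: laws, covariances, independence -/

/-- The column of inner products of the rows `z i` with a fixed vector. -/
noncomputable def column {B d : ℕ} (z : Fin d → EuclideanSpace ℝ (Fin B))
    (v : EuclideanSpace ℝ (Fin B)) : EuclideanSpace ℝ (Fin d) :=
  WithLp.toLp 2 fun i => inner ℝ (z i) v

/-- The law of `d` independent centered Gaussian rows with covariance matrix `S`. -/
noncomputable abbrev gaussianRows {B : ℕ} (d : ℕ) (S : Matrix (Fin B) (Fin B) ℝ) :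
    Measure (Fin d → EuclideanSpace ℝ (Fin B)) :=
  Measure.pi fun _ => multivariateGaussian 0 S

section Column

variable {B d : ℕ}

@[simp] lemma column_apply (z : Fin d → EuclideanSpace ℝ (Fin B))
    (v : EuclideanSpace ℝ (Fin B)) (i : Fin d) : column z v i = inner ℝ (z i) v := rfl

lemma column_add (z : Fin d → EuclideanSpace ℝ (Fin B)) (u v : EuclideanSpace ℝ (Fin B)) :
    column z (u + v) = column z u + column z v := by
  ext i; simp [inner_add_right]

lemma column_sub (z : Fin d → EuclideanSpace ℝ (Fin B)) (u v : EuclideanSpace ℝ (Fin B)) :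
    column z (u - v) = column z u - column z v := by
  ext i; simp [inner_sub_right]

lemma column_smul (z : Fin d → EuclideanSpace ℝ (Fin B)) (a : ℝ)
    (v : EuclideanSpace ℝ (Fin B)) : column z (a • v) = a • column z v := by
  ext i; simp [inner_smul_right]

lemma column_sum (z : Fin d → EuclideanSpace ℝ (Fin B)) {ι : Type*} (s : Finset ι)
    (v : ι → EuclideanSpace ℝ (Fin B)) : column z (∑ j ∈ s, v j) = ∑ j ∈ s, column z (v j) := by
  ext i; simp [inner_sum]

lemma inner_column (z : Fin d → EuclideanSpace ℝ (Fin B)) (v : EuclideanSpace ℝ (Fin B))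
    (c : EuclideanSpace ℝ (Fin d)) :
    inner ℝ (column z v) c = ∑ i, c i * inner ℝ (z i) v := by
  simp [PiLp.inner_apply]

lemma continuous_column_uncurry :
    Continuous fun p : (Fin d → EuclideanSpace ℝ (Fin B)) × EuclideanSpace ℝ (Fin B) =>
      column p.1 p.2 := by
  unfold column
  fun_prop

lemma continuous_column (v : EuclideanSpace ℝ (Fin B)) :
    Continuous fun z : Fin d → EuclideanSpace ℝ (Fin B) => column z v :=
  continuous_column_uncurry.comp (by fun_prop : Continuous fun z => (z, v))

end Column

section GaussianRows

variable {B d : ℕ} {S : Matrix (Fin B) (Fin B) ℝ}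

lemma hasGaussianLaw_rows :
    HasGaussianLaw (fun z : Fin d → EuclideanSpace ℝ (Fin B) => z) (gaussianRows d S) := by
  refine iIndepFun.hasGaussianLaw (X := fun i (z : Fin d → EuclideanSpace ℝ (Fin B)) => z i)
    (fun i => ?_) ?_
  · exact (measurePreserving_eval (fun _ : Fin d => multivariateGaussian 0 S) i).hasLaw.hasGaussianLaw
  · exact iIndepFun_pi (X := fun _ => id) (fun _ => aemeasurable_id)

lemma hasGaussianLaw_row_inner (i : Fin d) (v : EuclideanSpace ℝ (Fin B)) :
    HasGaussianLaw (fun z : Fin d → EuclideanSpace ℝ (Fin B) => inner ℝ (z i) v)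
      (gaussianRows d S) := by
  have h := (hasGaussianLaw_rows (d := d) (S := S)).map_fun
    ((innerSL ℝ v).comp (ContinuousLinearMap.proj (R := ℝ)
      (φ := fun _ : Fin d => EuclideanSpace ℝ (Fin B)) i))
  simpa [real_inner_comm] using h

lemma hasGaussianLaw_inner_column (v : EuclideanSpace ℝ (Fin B)) (c : EuclideanSpace ℝ (Fin d)) :
    HasGaussianLaw (fun z : Fin d → EuclideanSpace ℝ (Fin B) => inner ℝ (column z v) c)
      (gaussianRows d S) := by
  have h := (hasGaussianLaw_rows (d := d) (S := S)).map_fun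
    (∑ i, c i • (innerSL ℝ v).comp (ContinuousLinearMap.proj (R := ℝ)
      (φ := fun _ : Fin d => EuclideanSpace ℝ (Fin B)) i))
  simp_rw [inner_column]
  simpa [real_inner_comm] using h

lemma covariance_row_inner (hS : S.PosSemidef) (i k : Fin d) (u v : EuclideanSpace ℝ (Fin B)) :
    cov[fun z : Fin d → EuclideanSpace ℝ (Fin B) => inner ℝ (z i) u, fun z => inner ℝ (z k) v;
      gaussianRows d S] = if i = k then u ⬝ᵥ S *ᵥ v else 0 := by
  split_ifs with h
  · subst h
    have hl := (measurePreserving_eval (fun _ : Fin d => multivariateGaussian 0 S) i).hasLaw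
    have := hl.covariance_fun_comp (f := fun x => inner ℝ x u) (g := fun x => inner ℝ x v)
      (by fun_prop) (by fun_prop)
    simp only [Function.eval] at this
    rw [this, ← covarianceBilin_multivariateGaussian (μ := 0) hS u v,
      covarianceBilin_apply_eq_cov IsGaussian.memLp_two_id]
    simp_rw [real_inner_comm]
  · have hi : iIndepFun (fun i (z : Fin d → EuclideanSpace ℝ (Fin B)) => z i) (gaussianRows d S) :=
      iIndepFun_pi (X := fun _ => id) (fun _ => aemeasurable_id)
    have := (hi.indepFun h).comp (φ := fun x => inner ℝ x u) (ψ := fun x => inner ℝ x v)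
      (by fun_prop) (by fun_prop)
    exact this.covariance_eq_zero (hasGaussianLaw_row_inner i u).memLp_two
      (hasGaussianLaw_row_inner k v).memLp_two

lemma covariance_inner_column (hS : S.PosSemidef) (u v : EuclideanSpace ℝ (Fin B))
    (c e : EuclideanSpace ℝ (Fin d)) :
    cov[fun z : Fin d → EuclideanSpace ℝ (Fin B) => inner ℝ (column z u) c,
      fun z => inner ℝ (column z v) e; gaussianRows d S] = inner ℝ c e * (u ⬝ᵥ S *ᵥ v) := by
  simp_rw [inner_column]
  rw [covariance_fun_sum_fun_sum (fun i => (hasGaussianLaw_row_inner i u).memLp_two.const_mul _)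
    (fun i => (hasGaussianLaw_row_inner i v).memLp_two.const_mul _)]
  simp_rw [covariance_const_mul_left, covariance_const_mul_right, covariance_row_inner hS]
  simp [PiLp.inner_apply, Finset.sum_mul]
  exact Finset.sum_congr rfl fun i _ => by ring

lemma integral_inner_column (v : EuclideanSpace ℝ (Fin B)) (c : EuclideanSpace ℝ (Fin d)) :
    ∫ z, inner ℝ (column z v) c ∂(gaussianRows d S) = 0 := by
  simp_rw [inner_column]
  rw [integral_finsetSum _ fun i _ => (hasGaussianLaw_row_inner i v).integrable.const_mul _]
  refine Finset.sum_eq_zero fun i _ => ?_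
  rw [integral_const_mul]
  have hl := (measurePreserving_eval (fun _ : Fin d => multivariateGaussian 0 S) i)
  have h1 : ∫ z, inner ℝ (z i) v ∂(gaussianRows d S)
      = ∫ x, inner ℝ x v ∂(multivariateGaussian 0 S) := by
    rw [← hl.map_eq, integral_map hl.measurable.aemeasurable (by fun_prop)]
  rw [h1]
  have := (innerSL ℝ v).integral_comp_comm
    (IsGaussian.integrable_id (μ := multivariateGaussian (0 : EuclideanSpace ℝ (Fin B)) S))
  simp only [id, integral_id_multivariateGaussian, map_zero, innerSL_apply_apply] at this
  simp_rw [real_inner_comm, this]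
  simp

/-- The projection of a Gaussian column to a fixed direction is a centered real Gaussian. -/
lemma map_inner_column (hS : S.PosSemidef) (v : EuclideanSpace ℝ (Fin B))
    (c : EuclideanSpace ℝ (Fin d)) :
    (gaussianRows d S).map (fun z => inner ℝ (column z v) c)
      = gaussianReal 0 (‖c‖ ^ 2 * (v ⬝ᵥ S *ᵥ v)).toNNReal := by
  rw [(hasGaussianLaw_inner_column v c).map_eq_gaussianReal, integral_inner_column,
    ← covariance_self (hasGaussianLaw_inner_column v c).aemeasurable, covariance_inner_column hS,
    real_inner_self_eq_norm_sq]

/-- Families of columns that are uncorrelated with respect to `S` are independent. -/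
lemma indepFun_columns (hS : S.PosSemidef) {ι κ : Type*} [Finite ι] [Finite κ]
    (u : ι → EuclideanSpace ℝ (Fin B)) (v : κ → EuclideanSpace ℝ (Fin B))
    (h : ∀ i k, u i ⬝ᵥ S *ᵥ v k = 0) :
    IndepFun (fun (z : Fin d → EuclideanSpace ℝ (Fin B)) i => column z (u i))
      (fun z k => column z (v k)) (gaussianRows d S) := by
  -- All coordinates of all columns form one linear image `L` of the Gaussian rows, hence are
  -- jointly Gaussian, and vanishing covariances give independence.
  have hind := HasGaussianLaw.indepFun_of_covariance_eval (P := gaussianRows d S)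
    (X := fun (p : ι × Fin d) (z : Fin d → EuclideanSpace ℝ (Fin B)) => inner ℝ (z p.2) (u p.1))
    (Y := fun (p : κ × Fin d) (z : Fin d → EuclideanSpace ℝ (Fin B)) => inner ℝ (z p.2) (v p.1))
    ?_ ?_
  · have := hind.comp (φ := fun x i => (WithLp.toLp 2 fun k => x (i, k) : EuclideanSpace ℝ (Fin d)))
      (ψ := fun x i => (WithLp.toLp 2 fun k => x (i, k) : EuclideanSpace ℝ (Fin d)))
      (by fun_prop) (by fun_prop)
    exact this
  · let L : (Fin d → EuclideanSpace ℝ (Fin B)) →L[ℝ] ((ι × Fin d → ℝ) × (κ × Fin d → ℝ)) :=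
      ContinuousLinearMap.prod
        (ContinuousLinearMap.pi fun p => (innerSL ℝ (u p.1)).comp (ContinuousLinearMap.proj (R := ℝ)
          (φ := fun _ : Fin d => EuclideanSpace ℝ (Fin B)) p.2))
        (ContinuousLinearMap.pi fun p => (innerSL ℝ (v p.1)).comp (ContinuousLinearMap.proj (R := ℝ)
          (φ := fun _ : Fin d => EuclideanSpace ℝ (Fin B)) p.2))
    have := Fintype.ofFinite ι
    have := Fintype.ofFinite κ
    have h := (hasGaussianLaw_rows (d := d) (S := S)).map_fun L
    have hL : (fun z => L z) = fun z : Fin d → EuclideanSpace ℝ (Fin B) =>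
        (fun p : ι × Fin d => inner ℝ (z p.2) (u p.1), fun p : κ × Fin d => inner ℝ (z p.2) (v p.1)) := by
      funext z
      ext p <;> simp [L, real_inner_comm]
    rwa [hL] at h
  · intro p q
    rw [covariance_row_inner hS, h]
    simp

end GaussianRows

/-! ### Orthogonal residuals and their measurability -/

section Residual

variable {E ι : Type*} [NormedAddCommGroup E] [InnerProductSpace ℝ E] [FiniteDimensional ℝ E]

/-- The component of `h` orthogonal to the span of the family `X`. -/
@[irreducible] noncomputable def orthResidual (X : ι → E) (h : E) : E :=
  (Submodule.span ℝ (Set.range X))ᗮ.starProjection h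

lemma orthResidual_add (X : ι → E) (h e : E) :
    orthResidual X (h + e) = orthResidual X h + orthResidual X e := by
  simp only [orthResidual, map_add]

lemma orthResidual_sub (X : ι → E) (h e : E) :
    orthResidual X (h - e) = orthResidual X h - orthResidual X e := by
  simp only [orthResidual, map_sub]

lemma inner_orthResidual_of_mem (X : ι → E) (h : E) {u : E}
    (hu : u ∈ Submodule.span ℝ (Set.range X)) : inner ℝ (orthResidual X h) u = 0 := by
  rw [orthResidual]
  exact Submodule.inner_left_of_mem_orthogonal hu (Submodule.starProjection_apply_mem _ _)

lemma inner_orthResidual_family (X : ι → E) (h : E) (j : ι) :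
    inner ℝ (orthResidual X h) (X j) = 0 :=
  inner_orthResidual_of_mem X h (Submodule.subset_span ⟨j, rfl⟩)

lemma sub_orthResidual_mem (X : ι → E) (h : E) :
    h - orthResidual X h ∈ Submodule.span ℝ (Set.range X) := by
  rw [orthResidual, Submodule.starProjection_orthogonal_val, sub_sub_cancel]
  exact Submodule.starProjection_apply_mem _ _

lemma inner_orthResidual_self (X : ι → E) (h : E) :
    inner ℝ (orthResidual X h) h = ‖orthResidual X h‖ ^ 2 := by
  have := inner_orthResidual_of_mem X h (sub_orthResidual_mem X h)
  rw [inner_sub_right, real_inner_self_eq_norm_sq] at this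
  linarith

lemma inner_orthResidual_orthResidual (X : ι → E) (h e : E) :
    inner ℝ (orthResidual X h) (orthResidual X e) = inner ℝ (orthResidual X h) e := by
  have := inner_orthResidual_of_mem X h (sub_orthResidual_mem X e)
  rw [inner_sub_right] at this
  linarith

lemma norm_orthResidual_le (X : ι → E) (h : E) {u : E}
    (hu : u ∈ Submodule.span ℝ (Set.range X)) : ‖orthResidual X h‖ ≤ ‖h - u‖ := by
  have h0 : orthResidual X h = orthResidual X (h - u) := by
    have : (Submodule.span ℝ (Set.range X))ᗮ.starProjection u = 0 := by
      rw [Submodule.starProjection_orthogonal_val, Submodule.starProjection_eq_self_iff.mpr hu,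
        sub_self]
    rw [orthResidual_sub, orthResidual, orthResidual, this, sub_zero]
  rw [h0, orthResidual]
  exact Submodule.norm_starProjection_apply_le _ _

/-- The residual norm is the distance to the span, and the infimum is attained. Quantifying over
coefficients rather than over points of the span makes each condition open in `(X, h)`. -/
lemma norm_orthResidual_lt_iff [Fintype ι] (X : ι → E) (h : E) (r : ℝ) :
    ‖orthResidual X h‖ < r ↔ ∃ y : ι → ℝ, ‖h - ∑ j, y j • X j‖ < r := by
  constructor
  · intro hr
    obtain ⟨y, hy⟩ := (Submodule.mem_span_range_iff_exists_fun ℝ).1 (sub_orthResidual_mem X h)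
    exact ⟨y, by rwa [hy, sub_sub_cancel]⟩
  · rintro ⟨y, hy⟩
    exact (norm_orthResidual_le X h
      ((Submodule.mem_span_range_iff_exists_fun ℝ).2 ⟨y, rfl⟩)).trans_lt hy

variable [MeasurableSpace E] [BorelSpace E]

/-- The projection is discontinuous in `X` where the rank drops, but a distance to the span is upper
semicontinuous: its strict sublevel sets are unions of open sets. -/
lemma measurable_norm_orthResidual [Fintype ι] :
    Measurable fun p : (ι → E) × E => ‖orthResidual p.1 p.2‖ := by
  have : FiniteDimensional ℝ E := inferInstance
  have : SecondCountableTopology E := inferInstance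
  refine measurable_of_Iio fun r => ?_
  have : (fun p : (ι → E) × E => ‖orthResidual p.1 p.2‖) ⁻¹' Set.Iio r
      = ⋃ y : ι → ℝ, {p : (ι → E) × E | ‖p.2 - ∑ j, y j • p.1 j‖ < r} := by
    ext p
    simp [norm_orthResidual_lt_iff]
  rw [this]
  exact (isOpen_iUnion fun y => isOpen_lt (by fun_prop) (by fun_prop)).measurableSet

/-- Polarization reduces this to residual norms, because the projection is linear in `h` for fixed
`X`. -/
lemma measurable_inner_orthResidual [Fintype ι] (e : E) :
    Measurable fun p : (ι → E) × E => inner ℝ (orthResidual p.1 p.2) e := by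
  have h1 : Measurable fun p : (ι → E) × E => ‖orthResidual p.1 (p.2 + e)‖ :=
    measurable_norm_orthResidual.comp (by fun_prop : Measurable fun p : (ι → E) × E => (p.1, p.2 + e))
  have h2 : Measurable fun p : (ι → E) × E => ‖orthResidual p.1 (p.2 - e)‖ :=
    measurable_norm_orthResidual.comp (by fun_prop : Measurable fun p : (ι → E) × E => (p.1, p.2 - e))
  have : (fun p : (ι → E) × E => inner ℝ (orthResidual p.1 p.2) e) = fun p =>
      (‖orthResidual p.1 (p.2 + e)‖ ^ 2 - ‖orthResidual p.1 (p.2 - e)‖ ^ 2) / 4 := by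
    funext p
    rw [← inner_orthResidual_orthResidual]
    rw [orthResidual_add, orthResidual_sub]
    rw [norm_add_sq_real, norm_sub_sq_real]
    ring
  rw [this]
  fun_prop

end Residual

lemma measurable_orthResidual {ι : Type*} [Fintype ι] {d : ℕ} :
    Measurable fun p : (ι → EuclideanSpace ℝ (Fin d)) × EuclideanSpace ℝ (Fin d) =>
      orthResidual p.1 p.2 := by
  have h : Measurable fun p : (ι → EuclideanSpace ℝ (Fin d)) × EuclideanSpace ℝ (Fin d) =>
      (WithLp.toLp 2 fun i => inner ℝ (orthResidual p.1 p.2) (EuclideanSpace.single i (1 : ℝ)) :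
        EuclideanSpace ℝ (Fin d)) :=
    (WithLp.measurable_toLp 2 _).comp
      (measurable_pi_lambda _ fun i => measurable_inner_orthResidual (EuclideanSpace.single i (1 : ℝ)))
  convert h using 2 with p
  ext i
  simp [EuclideanSpace.inner_single_right]

/-! ### Gaussian tails and the lower tail of a projected norm -/

section Tail

lemma gaussianReal_real_le_abs_le (v : NNReal) {w a : ℝ} (hw : 0 < w) (hv : (v : ℝ) ≤ w)
    (ha : 0 ≤ a) :
    (gaussianReal 0 v).real {x | a ≤ |x|} ≤ 2 * Real.exp (-(a ^ 2 / (2 * w))) := by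
  have key : ∀ u : NNReal, (u : ℝ) ≤ w → (gaussianReal 0 u).real {x | a ≤ x}
      ≤ Real.exp (-(a ^ 2 / (2 * w))) := by
    intro u hu
    have h := measure_ge_le_exp_mul_mgf (μ := gaussianReal 0 u) (X := id) (t := a / w) a
      (by positivity) (integrable_exp_mul_gaussianReal _)
    rw [mgf_id_gaussianReal] at h
    refine h.trans ?_
    rw [← Real.exp_add]
    refine Real.exp_le_exp.2 ?_
    have : (u : ℝ) * (a / w) ^ 2 / 2 ≤ w * (a / w) ^ 2 / 2 := by gcongr
    have e : -(a / w) * a + w * (a / w) ^ 2 / 2 = -(a ^ 2 / (2 * w)) := by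
      field_simp; ring
    linarith
  have hneg : (gaussianReal 0 v).real {x | x ≤ -a} = (gaussianReal 0 v).real {x | a ≤ x} := by
    have : (gaussianReal 0 v).map (fun x => -x) = gaussianReal 0 v := by
      simp [gaussianReal_map_neg]
    conv_rhs => rw [← this]
    rw [map_measureReal_apply (f := fun x : ℝ => -x) (s := {x | a ≤ x}) (by fun_prop)
      (measurableSet_le measurable_const measurable_id)]
    congr 1
    ext x
    simp [le_neg]
  have hsub : {x : ℝ | a ≤ |x|} ⊆ {x | a ≤ x} ∪ {x | x ≤ -a} := fun x hx => by
    rcases le_abs.1 (show a ≤ |x| from hx) with h | h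
    · exact Or.inl h
    · exact Or.inr (by simp only [Set.mem_ofPred_eq]; linarith)
  calc _ ≤ (gaussianReal 0 v).real ({x | a ≤ x} ∪ {x | x ≤ -a}) := measureReal_mono hsub
    _ ≤ _ := measureReal_union_le _ _
    _ ≤ _ := by rw [hneg]; linarith [key v hv]

lemma integral_exp_neg_sq_gaussianReal {v : NNReal} (hv : v ≠ 0) :
    ∫ x, Real.exp (-(1 / (2 * v)) * x ^ 2) ∂(gaussianReal 0 v) = 1 / Real.sqrt 2 := by
  have hv' : (0 : ℝ) < v := by positivity
  rw [integral_gaussianReal_eq_integral_smul hv]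
  have : ∀ x : ℝ, gaussianPDFReal 0 v x • Real.exp (-(1 / (2 * v)) * x ^ 2)
      = (Real.sqrt (2 * Real.pi * v))⁻¹ * Real.exp (-(1 / v) * x ^ 2) := by
    intro x
    rw [gaussianPDFReal, smul_eq_mul, mul_assoc, ← Real.exp_add]
    congr 2
    field_simp
    ring
  simp_rw [this]
  rw [integral_const_mul, integral_gaussian, ← Real.sqrt_inv, ← Real.sqrt_mul (by positivity),
    ← Real.sqrt_one, ← Real.sqrt_div (by positivity)]
  congr 1
  field_simp
  simp

variable {B d : ℕ} {S : Matrix (Fin B) (Fin B) ℝ}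

/-- Lower tail of the squared norm of the projection of a Gaussian column to a subspace. -/
lemma prob_norm_sq_starProjection_le (hS : S.PosSemidef) (m : EuclideanSpace ℝ (Fin B))
    (hm : 0 < m ⬝ᵥ S *ᵥ m) (W : Submodule ℝ (EuclideanSpace ℝ (Fin d))) (r : ℝ) :
    (gaussianRows d S).real {z | ‖W.starProjection (column z m)‖ ^ 2 ≤ r * (m ⬝ᵥ S *ᵥ m)}
      ≤ Real.exp (r / 2) * (1 / Real.sqrt 2) ^ Module.finrank ℝ W := by
  set κ := m ⬝ᵥ S *ᵥ m with hκ
  set v : NNReal := κ.toNNReal with hvdef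
  have hv : v ≠ 0 := by simpa [hvdef] using hm
  have hvκ : (v : ℝ) = κ := Real.coe_toNNReal _ hm.le
  let b := stdOrthonormalBasis ℝ W
  let Y : Fin (Module.finrank ℝ W) → (Fin d → EuclideanSpace ℝ (Fin B)) → ℝ :=
    fun k z => inner ℝ (column z m) (b k : EuclideanSpace ℝ (Fin d))
  have hYm : ∀ k, Measurable (Y k) := fun k =>
    ((continuous_column m).inner continuous_const).measurable
  have hYlaw : ∀ k, (gaussianRows d S).map (Y k) = gaussianReal 0 v := by
    intro k
    have := map_inner_column (d := d) hS m (b k : EuclideanSpace ℝ (Fin d))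
    have hb : ‖(b k : EuclideanSpace ℝ (Fin d))‖ = 1 := b.orthonormal.1 k
    rw [this, hb]
    simp [hvdef, hκ]
  -- Coordinates in an orthonormal basis of `W` are uncorrelated and jointly Gaussian, so the
  -- squared norm is a sum of independent squares of variance `κ`.
  have hind : iIndepFun Y (gaussianRows d S) := by
    refine HasGaussianLaw.iIndepFun_of_covariance_eq_zero ?_ ?_
    · let L : (Fin d → EuclideanSpace ℝ (Fin B)) →L[ℝ] (Fin (Module.finrank ℝ W) → ℝ) :=
        ContinuousLinearMap.pi fun k => ∑ i, (b k : EuclideanSpace ℝ (Fin d)) i •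
          (innerSL ℝ m).comp (ContinuousLinearMap.proj (R := ℝ)
            (φ := fun _ : Fin d => EuclideanSpace ℝ (Fin B)) i)
      have h := (hasGaussianLaw_rows (d := d) (S := S)).map_fun L
      have hL : (fun z => L z) = fun z k => Y k z := by
        funext z k
        simp [L, Y, inner_column, real_inner_comm]
      rwa [hL] at h
    · intro i j hij
      have : inner ℝ (b i : EuclideanSpace ℝ (Fin d)) (b j) = 0 := by
        simpa using b.orthonormal.2 hij
      exact (covariance_inner_column hS m m _ _).trans (by rw [this, zero_mul])
  have hsum : ∀ z, ‖W.starProjection (column z m)‖ ^ 2 = ∑ k, (Y k z) ^ 2 := by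
    intro z
    have h1 : ‖W.starProjection (column z m)‖ = ‖W.orthogonalProjectionOnto (column z m)‖ := by
      simp
    rw [h1, ← b.sum_sq_norm_inner_right]
    refine Finset.sum_congr rfl fun k _ => ?_
    rw [Real.norm_eq_abs, sq_abs, real_inner_comm, Submodule.coe_inner,
      ← Submodule.starProjection_apply, Submodule.inner_starProjection_left_eq_right,
      Submodule.starProjection_eq_self_iff.2 (b k).2]
  have hind2 : iIndepFun (fun k z => (Y k z) ^ 2) (gaussianRows d S) :=
    hind.comp (fun _ x => x ^ 2) (fun _ => by fun_prop)
  have hmgf : ∀ k, mgf (fun z => (Y k z) ^ 2) (gaussianRows d S) (-(1 / (2 * κ)))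
      = 1 / Real.sqrt 2 := by
    intro k
    rw [mgf, ← integral_exp_neg_sq_gaussianReal hv, ← hYlaw k, integral_map (hYm k).aemeasurable
      (by fun_prop), hvκ]
  -- Chernoff's bound; at the parameter `-1/(2κ)` each square contributes exactly `1/√2`.
  have hch := measure_le_le_exp_mul_mgf (μ := gaussianRows d S)
    (X := ∑ k, fun z => (Y k z) ^ 2) (t := -(1 / (2 * κ))) (r * κ)
    (by rw [neg_nonpos]; positivity) ?_
  · rw [hind2.mgf_sum (fun k => (hYm k).pow_const 2) Finset.univ] at hch
    simp only [hmgf, Finset.prod_const, Finset.card_univ, Fintype.card_fin] at hch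
    have he : -(-(1 / (2 * κ))) * (r * κ) = r / 2 := by field_simp
    rw [he] at hch
    refine le_trans (le_of_eq ?_) hch
    congr 1
    ext z
    simp [hsum]
  · refine Integrable.of_bound (C := 1) ?_ (ae_of_all _ fun z => ?_)
    · have : Measurable (∑ k, fun z => (Y k z) ^ 2) := by
        convert Finset.measurable_sum Finset.univ fun k _ => (hYm k).pow_const 2 using 1
        ext z
        simp
      exact (this.const_mul _).exp.aestronglyMeasurable
    · rw [Real.norm_eq_abs, Real.abs_exp, Real.exp_le_one_iff, Finset.sum_apply]
      have h1 : 0 ≤ ∑ k, (Y k z) ^ 2 := Finset.sum_nonneg fun _ _ => sq_nonneg _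
      have h2 : 0 ≤ 1 / (2 * κ) := by positivity
      nlinarith

end Tail

/-! ### Conditioning on independent columns -/

section Conditioning

/-- A uniform bound on the sections of an event bounds its probability under independence. -/
lemma IndepFun.real_le_of_forall_section {Ω α β : Type*} [MeasurableSpace Ω] [MeasurableSpace α]
    [MeasurableSpace β] {μ : Measure Ω} [IsProbabilityMeasure μ] {X : Ω → α} {Y : Ω → β}
    (h : IndepFun X Y μ) (hX : Measurable X) (hY : Measurable Y) {s : Set (α × β)}
    (hs : MeasurableSet s) {c : ℝ} (hc : ∀ a, μ.real {ω | (a, Y ω) ∈ s} ≤ c) :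
    μ.real {ω | (X ω, Y ω) ∈ s} ≤ c := by
  have hc0 : 0 ≤ c := by
    obtain ⟨ω⟩ : Nonempty Ω := μ.nonempty_of_neZero
    exact measureReal_nonneg.trans (hc (X ω))
  have : μ {ω | (X ω, Y ω) ∈ s} ≤ ENNReal.ofReal c := by
    have h1 : μ {ω | (X ω, Y ω) ∈ s} = μ.map (fun ω => (X ω, Y ω)) s := by
      rw [Measure.map_apply (hX.prodMk hY) hs]; rfl
    rw [h1, (indepFun_iff_map_prod_eq_prod_map_map hX.aemeasurable hY.aemeasurable).1 h,
      Measure.prod_apply hs]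
    have : IsProbabilityMeasure (μ.map X) := Measure.isProbabilityMeasure_map hX.aemeasurable
    calc _ ≤ ∫⁻ _, ENNReal.ofReal c ∂(μ.map X) := by
          refine lintegral_mono fun a => ?_
          rw [Measure.map_apply hY (measurable_prodMk_left hs)]
          exact (ENNReal.le_ofReal_iff_toReal_le (measure_ne_top _ _) hc0).2 (hc a)
      _ = _ := by simp
  exact ENNReal.toReal_le_of_le_ofReal hc0 this

variable {B d n : ℕ} {S : Matrix (Fin B) (Fin B) ℝ}

lemma measurable_columns {ι : Type*} [Fintype ι] (u : ι → EuclideanSpace ℝ (Fin B)) :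
    Measurable fun (z : Fin d → EuclideanSpace ℝ (Fin B)) i => column z (u i) :=
  measurable_pi_lambda _ fun i => (continuous_column (u i)).measurable

/-- A Gaussian column keeps most of its length after projecting out few independent columns. -/
lemma prob_norm_sq_orthResidual_le (hS : S.PosSemidef) (u : Fin n → EuclideanSpace ℝ (Fin B))
    (m : EuclideanSpace ℝ (Fin B)) (hum : ∀ j, u j ⬝ᵥ S *ᵥ m = 0) (hm : 0 < m ⬝ᵥ S *ᵥ m)
    (hnd : 2 * n ≤ d) :
    (gaussianRows d S).real {z | ‖orthResidual (fun j => column z (u j)) (column z m)‖ ^ 2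
      ≤ d / 8 * (m ⬝ᵥ S *ᵥ m)} ≤ Real.exp (-(d / 16)) := by
  have hind := indepFun_columns (d := d) hS u (fun _ : Unit => m) (fun j _ => hum j)
  refine IndepFun.real_le_of_forall_section (hind.comp measurable_id (measurable_pi_apply ()))
    (measurable_columns u) (continuous_column m).measurable
    (s := {p | ‖orthResidual p.1 p.2‖ ^ 2 ≤ d / 8 * (m ⬝ᵥ S *ᵥ m)})
    (measurableSet_le (measurable_norm_orthResidual.pow_const 2) measurable_const) fun X => ?_
  have hle := prob_norm_sq_starProjection_le hS m hm (Submodule.span ℝ (Set.range X))ᗮ (d / 8)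
  have hset : ∀ z : Fin d → EuclideanSpace ℝ (Fin B), orthResidual X (column z m)
      = (Submodule.span ℝ (Set.range X))ᗮ.starProjection (column z m) := fun z => by
    rw [orthResidual]
  simp only [← hset] at hle
  refine hle.trans ?_
  -- The frozen columns span at most `n ≤ d/2` dimensions.
  have hdim : d ≤ 2 * Module.finrank ℝ (Submodule.span ℝ (Set.range X))ᗮ := by
    have h1 := Submodule.finrank_add_finrank_orthogonal (𝕜 := ℝ) (Submodule.span ℝ (Set.range X))
    have h2 : Module.finrank ℝ (Submodule.span ℝ (Set.range X)) ≤ n := by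
      exact (finrank_range_le_card (R := ℝ) X).trans_eq (Fintype.card_fin n)
    rw [finrank_euclideanSpace_fin] at h1
    omega
  set k := Module.finrank ℝ (Submodule.span ℝ (Set.range X))ᗮ
  have hlog : (1 / Real.sqrt 2) ^ k = Real.exp (-(k * (Real.log 2 / 2))) := by
    rw [← Real.log_sqrt (by norm_num)]
    conv_lhs => rw [← Real.exp_log (show (0 : ℝ) < 1 / Real.sqrt 2 by positivity),
      ← Real.exp_nat_mul]
    simp
  rw [hlog, ← Real.exp_add]
  refine Real.exp_le_exp.2 ?_
  have h3 : (d : ℝ) ≤ 2 * k := by exact_mod_cast hdim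
  -- The exponent is at most `d/16 - (log 2) d/4`, below `-d/16` because `log 2 > 1/2`.
  have h4 := Real.log_two_gt_d9
  nlinarith

/-- Tail of the inner product of the residual with an independent Gaussian column. -/
lemma prob_lt_abs_inner_orthResidual (hS : S.PosSemidef) (u : Fin n → EuclideanSpace ℝ (Fin B))
    (m y : EuclideanSpace ℝ (Fin B)) (huy : ∀ j, u j ⬝ᵥ S *ᵥ y = 0) (hmy : m ⬝ᵥ S *ᵥ y = 0)
    {s t R : ℝ} (hs : 0 < s) (hys : y ⬝ᵥ S *ᵥ y ≤ s) (ht : 0 ≤ t) (hR : 0 < R) :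
    (gaussianRows d S).real {z |
      R < ‖orthResidual (fun j => column z (u j)) (column z m)‖ ^ 2 ∧
      t * ‖orthResidual (fun j => column z (u j)) (column z m)‖ ^ 2
        < |inner ℝ (orthResidual (fun j => column z (u j)) (column z m)) (column z y)|}
      ≤ 2 * Real.exp (-(t ^ 2 * R / (2 * s))) := by
  -- The index `none` carries `m`: the residual is a function of this whole family, which is
  -- independent of the column of `y`.
  let u' : Option (Fin n) → EuclideanSpace ℝ (Fin B) := fun o => o.elim m u
  have hind := indepFun_columns (d := d) hS u' (fun _ : Unit => y) (by
    rintro (_ | j) _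
    · exact hmy
    · exact huy j)
  have hres : Measurable fun X : Option (Fin n) → EuclideanSpace ℝ (Fin d) =>
      orthResidual (fun j => X (some j)) (X none) :=
    measurable_orthResidual.comp (by fun_prop :
      Measurable fun X : Option (Fin n) → EuclideanSpace ℝ (Fin d) => (fun j => X (some j), X none))
  have hres1 : Measurable fun p : (Option (Fin n) → EuclideanSpace ℝ (Fin d)) ×
      EuclideanSpace ℝ (Fin d) => orthResidual (fun j => p.1 (some j)) (p.1 none) :=
    hres.comp measurable_fst
  refine IndepFun.real_le_of_forall_section (hind.comp measurable_id (measurable_pi_apply ()))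
    (measurable_columns u') (continuous_column y).measurable
    (s := {p | R < ‖orthResidual (fun j => p.1 (some j)) (p.1 none)‖ ^ 2 ∧
      t * ‖orthResidual (fun j => p.1 (some j)) (p.1 none)‖ ^ 2
        < |inner ℝ (orthResidual (fun j => p.1 (some j)) (p.1 none)) p.2|})
    ?_ fun X => ?_
  · refine (measurableSet_lt measurable_const (hres1.norm.pow_const 2)).inter
      (measurableSet_lt ((hres1.norm.pow_const 2).const_mul _) ?_)
    exact continuous_abs.measurable.comp (hres1.inner measurable_snd)
  · simp only [Set.mem_ofPred_eq]
    set r := orthResidual (fun j => X (some j)) (X none)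
    by_cases hr : R < ‖r‖ ^ 2
    swap
    · simp only [hr, false_and, Set.ofPred_false, measureReal_empty]
      positivity
    have hmeas : Measurable fun z : Fin d → EuclideanSpace ℝ (Fin B) => inner ℝ (column z y) r :=
      ((continuous_column y).inner continuous_const).measurable
    have hr0 : 0 < ‖r‖ ^ 2 := hR.trans hr
    calc _ ≤ (gaussianRows d S).real ((fun z => inner ℝ (column z y) r) ⁻¹'
          {x | t * ‖r‖ ^ 2 ≤ |x|}) := by
          refine measureReal_mono ?_
          rintro z ⟨-, hz⟩
          simp only [Set.mem_preimage, Set.mem_ofPred_eq]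
          rw [real_inner_comm]
          exact hz.le
      _ = (gaussianReal 0 (‖r‖ ^ 2 * (y ⬝ᵥ S *ᵥ y)).toNNReal).real {x | t * ‖r‖ ^ 2 ≤ |x|} := by
          rw [← map_inner_column hS, map_measureReal_apply hmeas
            (measurableSet_le measurable_const continuous_abs.measurable)]
      _ ≤ 2 * Real.exp (-((t * ‖r‖ ^ 2) ^ 2 / (2 * (‖r‖ ^ 2 * s)))) := by
          refine gaussianReal_real_le_abs_le _ (by positivity) ?_ (by positivity)
          rw [Real.coe_toNNReal']
          refine max_le ?_ (by positivity)
          gcongr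
      _ ≤ _ := by
          have : (t * ‖r‖ ^ 2) ^ 2 / (2 * (‖r‖ ^ 2 * s)) = t ^ 2 * ‖r‖ ^ 2 / (2 * s) := by
            field_simp
          rw [this]
          gcongr

end Conditioning

/-! ### Minimum-norm interpolation on random features -/

/-- The mean of the features of the training points. -/
noncomputable def meanFeature (n B : ℕ) : EuclideanSpace ℝ (Fin B) :=
  (n : ℝ)⁻¹ • ∑ i : Fin n, fourierFeature B (trainPoint n i)

section Interpolation

variable {B d n : ℕ}

lemma rfsFeature_eq_column (z : Fin d → EuclideanSpace ℝ (Fin B)) (x : ℝ) :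
    rfsFeature z x = column z (fourierFeature B x) := rfl

lemma minInterpolator_eq {D : ℕ} {Φ : ℝ → EuclideanSpace ℝ (Fin D)}
    {J : EuclideanSpace ℝ (Fin D) → ℝ} {c : EuclideanSpace ℝ (Fin D)}
    (hc : IsMinInterpolator n Φ J c) (h : ∃! c, IsMinInterpolator n Φ J c) :
    minInterpolator n Φ J = c := by
  rw [minInterpolator, dif_pos h.exists]
  exact h.unique h.exists.choose_spec hc

/-- Strict growth of the objective away from `c` gives a unique minimizer. -/
lemma existsUnique_isMinInterpolator {D : ℕ} {Φ : ℝ → EuclideanSpace ℝ (Fin D)}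
    {J : EuclideanSpace ℝ (Fin D) → ℝ} {c : EuclideanSpace ℝ (Fin D)} (hc : Interpolates n Φ c)
    (hJ : ∀ c', Interpolates n Φ c' → c' ≠ c → J c < J c') :
    (∃! c, IsMinInterpolator n Φ J c) ∧ minInterpolator n Φ J = c := by
  have hmin : IsMinInterpolator n Φ J c := ⟨hc, fun c' hc' => by
    rcases eq_or_ne c' c with rfl | h
    · exact le_rfl
    · exact (hJ c' hc' h).le⟩
  have hex : ∃! c, IsMinInterpolator n Φ J c := ⟨c, hmin, fun c' hc' => by
    by_contra h
    exact absurd (hc'.2 c hc) (not_le.2 (hJ c' hc'.1 h))⟩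
  exact ⟨hex, minInterpolator_eq hmin hex⟩

/-- The part of the mean column that is orthogonal to the centered columns. -/
noncomputable def meanResidual (n : ℕ) (z : Fin d → EuclideanSpace ℝ (Fin B)) :
    EuclideanSpace ℝ (Fin d) :=
  orthResidual (fun j : Fin n => column z (fourierFeature B (trainPoint n j) - meanFeature n B))
    (column z (meanFeature n B))

lemma inner_meanResidual_column (z : Fin d → EuclideanSpace ℝ (Fin B)) (j : Fin n) :
    inner ℝ (meanResidual n z) (column z (fourierFeature B (trainPoint n j)))
      = ‖meanResidual n z‖ ^ 2 := by
  have h1 := inner_orthResidual_family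
    (fun j : Fin n => column z (fourierFeature B (trainPoint n j) - meanFeature n B))
    (column z (meanFeature n B)) j
  have h2 := inner_orthResidual_self
    (fun j : Fin n => column z (fourierFeature B (trainPoint n j) - meanFeature n B))
    (column z (meanFeature n B))
  rw [column_sub, inner_sub_right] at h1
  rw [meanResidual]
  linarith

lemma column_meanFeature (z : Fin d → EuclideanSpace ℝ (Fin B)) :
    column z (meanFeature n B)
      = (n : ℝ)⁻¹ • ∑ i : Fin n, column z (fourierFeature B (trainPoint n i)) := by
  rw [meanFeature, column_smul, column_sum]

/-- An interpolator annihilates the centered columns and has product `1` with the mean column, hence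
product `1` with the residual `r`. The shortest such vector is `r/‖r‖²`, which itself interpolates.
No linear independence of the training columns is needed. -/
lemma rfs_interpolation (hn : 0 < n) (z : Fin d → EuclideanSpace ℝ (Fin B))
    (hz : meanResidual n z ≠ 0) :
    (∃! β, IsMinInterpolator n (rfsFeature z) (fun b => ‖b‖) β) ∧
    ∀ x, rfsFit n z x = inner ℝ (meanResidual n z) (column z (fourierFeature B x))
      / ‖meanResidual n z‖ ^ 2 := by
  set r := meanResidual n z with hr
  have hr0 : 0 < ‖r‖ ^ 2 := by positivity
  have hn' : (n : ℝ) ≠ 0 := by positivity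
  have hfeas : Interpolates n (rfsFeature z) ((‖r‖ ^ 2)⁻¹ • r) := by
    intro i
    rw [rfsFeature_eq_column, real_inner_smul_left, inner_meanResidual_column, ← hr, fstar]
    exact inv_mul_cancel₀ hr0.ne'
  have key : ∀ c, Interpolates n (rfsFeature z) c → inner ℝ c r = 1 := by
    intro c hc
    have hc' : ∀ j : Fin n, inner ℝ c (column z (fourierFeature B (trainPoint n j))) = 1 :=
      fun j => hc j
    have hm : inner ℝ c (column z (meanFeature n B)) = 1 := by
      rw [column_meanFeature, real_inner_smul_right, inner_sum]
      simp [hc', hn']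
    have hmem := sub_orthResidual_mem
      (fun j : Fin n => column z (fourierFeature B (trainPoint n j) - meanFeature n B))
      (column z (meanFeature n B))
    obtain ⟨y, hy⟩ := (Submodule.mem_span_range_iff_exists_fun ℝ).1 hmem
    have h0 : inner ℝ c (column z (meanFeature n B) - r) = 0 := by
      rw [hr, meanResidual, ← hy, inner_sum]
      refine Finset.sum_eq_zero fun j _ => ?_
      rw [real_inner_smul_right, column_sub, inner_sub_right, hc' j, hm]
      simp
    rw [inner_sub_right, hm] at h0
    linarith
  obtain ⟨h1, h2⟩ := existsUnique_isMinInterpolator (J := fun b => ‖b‖) hfeas (fun c hc hne => by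
    -- Given `⟨c, r⟩ = 1`, expanding this square gives `‖c‖² - ‖r‖⁻²`.
    have hpos : 0 < ‖c - (‖r‖ ^ 2)⁻¹ • r‖ ^ 2 := by
      have : c - (‖r‖ ^ 2)⁻¹ • r ≠ 0 := sub_ne_zero.2 hne
      positivity
    rw [norm_sub_sq_real, real_inner_smul_right, key c hc, norm_smul, mul_pow, norm_inv,
      Real.norm_of_nonneg hr0.le] at hpos
    have hlt : ‖(‖r‖ ^ 2)⁻¹ • r‖ ^ 2 < ‖c‖ ^ 2 := by
      rw [norm_smul, mul_pow, norm_inv, Real.norm_of_nonneg hr0.le]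
      have : (‖r‖ ^ 2)⁻¹ ^ 2 * ‖r‖ ^ 2 = (‖r‖ ^ 2)⁻¹ := by
        field_simp
      linarith
    exact lt_of_pow_lt_pow_left₀ 2 (norm_nonneg _) hlt)
  refine ⟨h1, fun x => ?_⟩
  rw [rfsFit, h2, rfsFeature_eq_column, real_inner_smul_left]
  field_simp

end Interpolation

/-! ### Weighted minimum-norm interpolation -/

section Weighted

variable {n B : ℕ} {q : ℝ}

/-- The bilinear form of the weighting matrix as a sum. -/
lemma dotProduct_bilevelSigma (u v : EuclideanSpace ℝ (Fin B)) :
    u ⬝ᵥ bilevelSigma n B q *ᵥ v = ∑ j, bilevelWeight n B q j * u j * v j := by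
  rw [bilevelSigma, dotProduct]
  refine Finset.sum_congr rfl fun j _ => ?_
  rw [mulVec_diagonal]
  ring

lemma posSemidef_bilevelSigma (hw : ∀ j, 0 < bilevelWeight n B q j) :
    (bilevelSigma n B q).PosSemidef :=
  PosSemidef.diagonal fun j => (hw j).le

lemma sum_inner_sub_eq_zero {D : ℕ} {Φ : ℝ → EuclideanSpace ℝ (Fin D)}
    {c c' : EuclideanSpace ℝ (Fin D)} (hc : Interpolates n Φ c) (hc' : Interpolates n Φ c')  :
    inner ℝ (c' - c) ((n : ℝ)⁻¹ • ∑ i : Fin n, Φ (trainPoint n i)) = 0 := by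
  rw [real_inner_smul_right, inner_sum, Finset.sum_eq_zero, mul_zero]
  intro i _
  rw [inner_sub_left, hc i, hc' i, sub_self]

/-- When the mean feature has constant weighted products `κ` with the training features, it is,
up to scaling, the image of the weighted minimum-norm interpolator. -/
lemma fourier_interpolation (hw : ∀ j, 0 < bilevelWeight n B q j) {κ : ℝ} (hκ : κ ≠ 0)
    (h : ∀ i : Fin n, meanFeature n B ⬝ᵥ bilevelSigma n B q *ᵥ fourierFeature B (trainPoint n i)
      = κ) :
    (∃! α, IsMinInterpolator n (fourierFeature B) (weightedNorm n B q) α) ∧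
    ∀ x, fourierFit n B q x
      = (meanFeature n B ⬝ᵥ bilevelSigma n B q *ᵥ fourierFeature B x) / κ := by
  set α : EuclideanSpace ℝ (Fin B) :=
    WithLp.toLp 2 fun j => bilevelWeight n B q j * meanFeature n B j / κ with hα
  have hfit : ∀ x, inner ℝ α (fourierFeature B x)
      = (meanFeature n B ⬝ᵥ bilevelSigma n B q *ᵥ fourierFeature B x) / κ := by
    intro x
    rw [dotProduct_bilevelSigma, PiLp.inner_apply, Finset.sum_div]
    refine Finset.sum_congr rfl fun j _ => ?_
    simp only [hα, RCLike.inner_apply, conj_trivial]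
    ring
  have hfeas : Interpolates n (fourierFeature B) α := fun i => by
    rw [hfit, h i, fstar, div_self hκ]
  have hnorm : ∀ c, weightedNorm n B q c ^ 2 = ∑ j, (bilevelWeight n B q j)⁻¹ * c j ^ 2 := by
    intro c
    rw [weightedNorm, EuclideanSpace.real_norm_sq_eq]
    refine Finset.sum_congr rfl fun j _ => ?_
    simp only []
    rw [mul_pow, ← Real.rpow_natCast, ← Real.rpow_mul (hw j).le]
    norm_num [Real.rpow_neg_one]
  obtain ⟨h1, h2⟩ := existsUnique_isMinInterpolator (J := weightedNorm n B q) hfeas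
    (fun c hc hne => by
      -- `Σ⁻¹α` is the mean feature over `κ`, and a difference of interpolators is orthogonal to
      -- every training feature; Pythagoras in the weighted norm then gives strict minimality.
      have horth : ∑ j, (bilevelWeight n B q j)⁻¹ * (α j * (c j - α j)) = 0 := by
        have h0 := sum_inner_sub_eq_zero hfeas hc
        rw [← meanFeature, PiLp.inner_apply] at h0
        rw [← zero_div κ, ← h0, Finset.sum_div]
        refine Finset.sum_congr rfl fun j _ => ?_
        have := (hw j).ne'
        simp only [hα, RCLike.inner_apply, conj_trivial, PiLp.sub_apply]
        field_simp
      have hpos : 0 < ∑ j, (bilevelWeight n B q j)⁻¹ * (c j - α j) ^ 2 := by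
        obtain ⟨j, hj⟩ : ∃ j, c j ≠ α j := by
          by_contra! hcon
          exact hne (by ext j; exact hcon j)
        refine Finset.sum_pos' (fun j _ => ?_) ⟨j, Finset.mem_univ _, ?_⟩
        · have := hw j
          positivity
        · have := hw j
          have : c j - α j ≠ 0 := sub_ne_zero.2 hj
          positivity
      have hexp : weightedNorm n B q c ^ 2 = weightedNorm n B q α ^ 2
          + 2 * ∑ j, (bilevelWeight n B q j)⁻¹ * (α j * (c j - α j))
          + ∑ j, (bilevelWeight n B q j)⁻¹ * (c j - α j) ^ 2 := by
        rw [hnorm, hnorm, Finset.mul_sum, ← Finset.sum_add_distrib, ← Finset.sum_add_distrib]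
        exact Finset.sum_congr rfl fun j _ => by ring
      refine lt_of_pow_lt_pow_left₀ 2 (norm_nonneg _) ?_
      rw [horth] at hexp
      linarith)
  exact ⟨h1, fun x => by rw [fourierFit, h2, hfit]⟩

/-- Orthogonal decomposition along finitely many vectors for a weighted inner product. -/
lemma exists_weighted_decomposition (hw : ∀ j, 0 < bilevelWeight n B q j)
    {ι : Type*} [Fintype ι] (u : ι → EuclideanSpace ℝ (Fin B)) (v : EuclideanSpace ℝ (Fin B)) :
    ∃ (a : ι → ℝ) (y : EuclideanSpace ℝ (Fin B)), v = ∑ j, a j • u j + y ∧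
      (∀ j, u j ⬝ᵥ bilevelSigma n B q *ᵥ y = 0) ∧
      y ⬝ᵥ bilevelSigma n B q *ᵥ y ≤ v ⬝ᵥ bilevelSigma n B q *ᵥ v := by
  -- `D` is the square root of `Σ`, which turns the weighted product into the standard one.
  let D : EuclideanSpace ℝ (Fin B) →ₗ[ℝ] EuclideanSpace ℝ (Fin B) :=
    { toFun := fun w => WithLp.toLp 2 fun j => Real.sqrt (bilevelWeight n B q j) * w j
      map_add' := fun w w' => by ext j; simp [mul_add]
      map_smul' := fun c w => by ext j; simp [mul_left_comm] }
  have hD : ∀ w w' : EuclideanSpace ℝ (Fin B),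
      w ⬝ᵥ bilevelSigma n B q *ᵥ w' = inner ℝ (D w) (D w') := by
    intro w w'
    rw [dotProduct_bilevelSigma, PiLp.inner_apply]
    refine Finset.sum_congr rfl fun j _ => ?_
    have := Real.mul_self_sqrt (hw j).le
    simp only [D, LinearMap.coe_mk, AddHom.coe_mk, RCLike.inner_apply, conj_trivial]
    linear_combination (-(w j * w' j)) * this
  obtain ⟨a, ha⟩ := (Submodule.mem_span_range_iff_exists_fun ℝ).1
    (sub_orthResidual_mem (fun j => D (u j)) (D v))
  have hy : D (v - ∑ j, a j • u j) = orthResidual (fun j => D (u j)) (D v) := by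
    rw [map_sub, map_sum]
    simp_rw [map_smul]
    rw [ha, sub_sub_cancel]
  refine ⟨a, v - ∑ j, a j • u j, by abel, fun j => ?_, ?_⟩
  · rw [hD, hy, real_inner_comm]
    exact inner_orthResidual_family (fun j => D (u j)) (D v) j
  · rw [hD, hD, hy, real_inner_self_eq_norm_sq, real_inner_self_eq_norm_sq]
    have := norm_orthResidual_le (fun j => D (u j)) (D v) (Submodule.zero_mem _)
    rw [sub_zero] at this
    gcongr

end Weighted

instance : IsProbabilityMeasure unif :=
  cond_isProbabilityMeasure_of_finite (by simp) (by simp)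

lemma continuous_fourierFeature (B : ℕ) : Continuous (fourierFeature B) := by
  refine (PiLp.continuous_toLp 2 _).comp (continuous_pi fun j => ?_)
  split_ifs <;> fun_prop

lemma continuous_fourierFit (n B : ℕ) (q : ℝ) : Continuous (fourierFit n B q) :=
  continuous_const.inner (continuous_fourierFeature B)

/-! ### Concentration of the random fit around the Fourier fit -/

section Error

variable {n B d : ℕ} {q κ s : ℝ}

lemma measurable_meanResidual :
    Measurable fun z : Fin d → EuclideanSpace ℝ (Fin B) => meanResidual n z :=
  measurable_orthResidual.comp ((measurable_columns _).prodMk (continuous_column _).measurable)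

lemma bilevelSigma_comm (u v : EuclideanSpace ℝ (Fin B)) :
    u ⬝ᵥ bilevelSigma n B q *ᵥ v = v ⬝ᵥ bilevelSigma n B q *ᵥ u := by
  rw [dotProduct_bilevelSigma, dotProduct_bilevelSigma]
  exact Finset.sum_congr rfl fun j _ => by ring

lemma bilevelSigma_sub_left (u v w : EuclideanSpace ℝ (Fin B)) :
    (u - v : EuclideanSpace ℝ (Fin B)) ⬝ᵥ bilevelSigma n B q *ᵥ w
      = u ⬝ᵥ bilevelSigma n B q *ᵥ w - v ⬝ᵥ bilevelSigma n B q *ᵥ w := by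
  rw [WithLp.ofLp_sub, sub_dotProduct]

lemma bilevelSigma_sum_smul_left {ι : Type*} (t : Finset ι) (a : ι → ℝ)
    (u : ι → EuclideanSpace ℝ (Fin B)) (w : EuclideanSpace ℝ (Fin B)) :
    (∑ j ∈ t, a j • u j : EuclideanSpace ℝ (Fin B)) ⬝ᵥ bilevelSigma n B q *ᵥ w
      = ∑ j ∈ t, a j * (u j ⬝ᵥ bilevelSigma n B q *ᵥ w) := by
  simp_rw [dotProduct_bilevelSigma, Finset.mul_sum]
  rw [Finset.sum_comm]
  refine Finset.sum_congr rfl fun j _ => ?_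
  simp only [WithLp.ofLp_sum, Finset.sum_apply, PiLp.smul_apply, smul_eq_mul, Finset.mul_sum,
    Finset.sum_mul]
  exact Finset.sum_congr rfl fun k _ => by ring

lemma bilevelSigma_mean_left (w : EuclideanSpace ℝ (Fin B)) :
    meanFeature n B ⬝ᵥ bilevelSigma n B q *ᵥ w
      = (n : ℝ)⁻¹ * ∑ i : Fin n, fourierFeature B (trainPoint n i) ⬝ᵥ bilevelSigma n B q *ᵥ w := by
  have : meanFeature n B = ∑ i : Fin n, (n : ℝ)⁻¹ • fourierFeature B (trainPoint n i) := by
    rw [meanFeature, Finset.smul_sum]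
  rw [this, bilevelSigma_sum_smul_left, Finset.mul_sum]

lemma bilevelSigma_mean_mean (hn : 0 < n)
    (h : ∀ i : Fin n, meanFeature n B ⬝ᵥ bilevelSigma n B q *ᵥ fourierFeature B (trainPoint n i)
      = κ) :
    meanFeature n B ⬝ᵥ bilevelSigma n B q *ᵥ meanFeature n B = κ := by
  rw [bilevelSigma_mean_left]
  simp_rw [bilevelSigma_comm _ (meanFeature n B), h]
  have : (n : ℝ) ≠ 0 := by positivity
  simp [this]

lemma prob_meanResidual_le (hw : ∀ j, 0 < bilevelWeight n B q j) (hκ : 0 < κ)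
    (h : ∀ i : Fin n, meanFeature n B ⬝ᵥ bilevelSigma n B q *ᵥ fourierFeature B (trainPoint n i)
      = κ) (hn : 0 < n) (hnd : 2 * n ≤ d) :
    (gaussianRows d (bilevelSigma n B q)).real {z | ‖meanResidual n z‖ ^ 2 ≤ d / 8 * κ}
      ≤ Real.exp (-(d / 16)) := by
  have hmm := bilevelSigma_mean_mean hn h
  have := prob_norm_sq_orthResidual_le (d := d) (posSemidef_bilevelSigma hw)
    (fun j : Fin n => fourierFeature B (trainPoint n j) - meanFeature n B) (meanFeature n B)
    (fun j => by rw [bilevelSigma_sub_left, bilevelSigma_comm, h, hmm, sub_self])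
    (by rwa [hmm]) hnd
  rwa [hmm] at this

/-- Pointwise concentration of the random fit around the Fourier fit. -/
lemma prob_lt_abs_fit_sub_fit (hw : ∀ j, 0 < bilevelWeight n B q j) (hκ : 0 < κ)
    (h : ∀ i : Fin n, meanFeature n B ⬝ᵥ bilevelSigma n B q *ᵥ fourierFeature B (trainPoint n i)
      = κ) (hn : 0 < n) (hd : 0 < d) (hs : 0 < s) (x : ℝ)
    (hx : fourierFeature B x ⬝ᵥ bilevelSigma n B q *ᵥ fourierFeature B x ≤ s)
    {t : ℝ} (ht : 0 ≤ t) :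
    (gaussianRows d (bilevelSigma n B q)).real {z | d / 8 * κ < ‖meanResidual n z‖ ^ 2 ∧
      t < |rfsFit n z x - fourierFit n B q x|}
      ≤ 2 * Real.exp (-(t ^ 2 * (d / 8 * κ) / (2 * s))) := by
  obtain ⟨a, y, hay, huy, hyy⟩ := exists_weighted_decomposition hw
    (fun j : Fin n => fourierFeature B (trainPoint n j)) (fourierFeature B x)
  have hmy : meanFeature n B ⬝ᵥ bilevelSigma n B q *ᵥ y = 0 := by
    rw [bilevelSigma_mean_left]
    simp [huy]
  have hR : 0 < d / 8 * κ := by positivity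
  refine le_trans (measureReal_mono ?_) (prob_lt_abs_inner_orthResidual (d := d)
    (posSemidef_bilevelSigma hw)
    (fun j : Fin n => fourierFeature B (trainPoint n j) - meanFeature n B) (meanFeature n B) y
    (fun j => by rw [bilevelSigma_sub_left, huy, hmy, sub_self]) hmy hs (hyy.trans hx) ht hR)
  rintro z ⟨h1, h2⟩
  refine ⟨h1, ?_⟩
  change _ < |inner ℝ (meanResidual n z) (column z y)|
  change t * ‖meanResidual n z‖ ^ 2 < _
  have hr0 : 0 < ‖meanResidual n z‖ ^ 2 := hR.trans h1
  have hz : meanResidual n z ≠ 0 := fun h0 => by simp [h0] at hr0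
  have hfit := (rfs_interpolation hn z hz).2 x
  -- Pairing the decomposition of `φ(x)` with the mean feature kills `y` and gives `κ` for each
  -- training feature. The random fit has the same main term, so only `y` contributes to the
  -- difference.
  have hsum : fourierFit n B q x = ∑ j, a j := by
    rw [(fourier_interpolation hw hκ.ne' h).2 x, bilevelSigma_comm]
    have : fourierFeature B x ⬝ᵥ bilevelSigma n B q *ᵥ meanFeature n B = ∑ j, a j * κ := by
      rw [hay, WithLp.ofLp_add, add_dotProduct, bilevelSigma_comm y, hmy, bilevelSigma_sum_smul_left,
        add_zero]
      exact Finset.sum_congr rfl fun j _ => by rw [bilevelSigma_comm, h]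
    rw [this, ← Finset.sum_mul, mul_div_cancel_right₀ _ hκ.ne']
  have hcol : inner ℝ (meanResidual n z) (column z (fourierFeature B x))
      = (∑ j, a j) * ‖meanResidual n z‖ ^ 2 + inner ℝ (meanResidual n z) (column z y) := by
    rw [hay, column_add, column_sum, inner_add_right, inner_sum, Finset.sum_mul]
    congr 1
    refine Finset.sum_congr rfl fun j _ => ?_
    rw [column_smul, real_inner_smul_right, inner_meanResidual_column]
  have hdiff : rfsFit n z x - fourierFit n B q x
      = inner ℝ (meanResidual n z) (column z y) / ‖meanResidual n z‖ ^ 2 := by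
    rw [hfit, hsum, hcol]
    field_simp
    ring
  have h3 : t < |rfsFit n z x - fourierFit n B q x| := h2
  rw [hdiff, abs_div, abs_of_pos hr0, lt_div_iff₀ hr0] at h3
  exact h3

/-- The random fit is close to the Fourier fit at most points, with high probability. -/
lemma prob_le_unif_fit_sub_fit (hw : ∀ j, 0 < bilevelWeight n B q j) (hκ : 0 < κ)
    (h : ∀ i : Fin n, meanFeature n B ⬝ᵥ bilevelSigma n B q *ᵥ fourierFeature B (trainPoint n i)
      = κ) (hn : 0 < n) (hd : 0 < d) (hs : 0 < s)
    (hx : ∀ x, fourierFeature B x ⬝ᵥ bilevelSigma n B q *ᵥ fourierFeature B x ≤ s)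
    {t ε : ℝ} (ht : 0 ≤ t) (hε : 0 < ε) :
    (gaussianRows d (bilevelSigma n B q)).real {z | d / 8 * κ < ‖meanResidual n z‖ ^ 2 ∧
      ε ≤ unif.real {x | t < |rfsFit n z x - fourierFit n B q x|}}
      ≤ 2 * Real.exp (-(t ^ 2 * (d / 8 * κ) / (2 * s))) / ε := by
  set ρ := 2 * Real.exp (-(t ^ 2 * (d / 8 * κ) / (2 * s))) with hρ
  have hρ0 : 0 ≤ ρ := by positivity
  set P := gaussianRows d (bilevelSigma n B q)
  have hR : 0 < d / 8 * κ := by positivity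
  -- The random fit is defined by a choice of minimizer; this explicit formula is jointly measurable
  -- and equals the difference of the fits where the residual is large.
  let G : (Fin d → EuclideanSpace ℝ (Fin B)) × ℝ → ℝ := fun p =>
    inner ℝ (meanResidual n p.1) (column p.1 (fourierFeature B p.2)) / ‖meanResidual n p.1‖ ^ 2
      - fourierFit n B q p.2
  have hr1 : Measurable fun p : (Fin d → EuclideanSpace ℝ (Fin B)) × ℝ => meanResidual n p.1 :=
    measurable_meanResidual.comp measurable_fst
  have hcol : Continuous fun p : (Fin d → EuclideanSpace ℝ (Fin B)) × ℝ =>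
      column p.1 (fourierFeature B p.2) :=
    continuous_column_uncurry.comp
      (continuous_fst.prodMk ((continuous_fourierFeature B).comp continuous_snd))
  have hG : Measurable G :=
    ((hr1.inner hcol.measurable).div (hr1.norm.pow_const 2)).sub
      ((continuous_fourierFit n B q).measurable.comp measurable_snd)
  let A : Set ((Fin d → EuclideanSpace ℝ (Fin B)) × ℝ) :=
    {p | d / 8 * κ < ‖meanResidual n p.1‖ ^ 2 ∧ t < |G p|}
  have hA : MeasurableSet A :=
    (measurableSet_lt measurable_const (hr1.norm.pow_const 2)).inter
      (measurableSet_lt measurable_const (continuous_abs.measurable.comp hG))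
  have hGfit : ∀ z x, d / 8 * κ < ‖meanResidual n z‖ ^ 2 →
      G (z, x) = rfsFit n z x - fourierFit n B q x := by
    intro z x hz
    have hz0 : meanResidual n z ≠ 0 := fun h0 => by
      rw [h0] at hz
      simp at hz
      linarith
    rw [(rfs_interpolation hn z hz0).2 x]
  have hsec : ∀ x, P ((fun z => (z, x)) ⁻¹' A) ≤ ENNReal.ofReal ρ := by
    intro x
    refine (ENNReal.le_ofReal_iff_toReal_le (measure_ne_top _ _) hρ0).2 ?_
    refine le_trans (measureReal_mono ?_) (prob_lt_abs_fit_sub_fit hw hκ h hn hd hs x (hx x) ht)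
    rintro z ⟨h1, h2⟩
    refine ⟨h1, ?_⟩
    rw [← hGfit z x h1]
    exact h2
  -- By Fubini the expected measure of bad points inherits the pointwise bound; Markov's inequality
  -- concludes.
  have htot : ∫⁻ z, unif (Prod.mk z ⁻¹' A) ∂P ≤ ENNReal.ofReal ρ := by
    rw [← Measure.prod_apply hA, Measure.prod_apply_symm hA]
    calc _ ≤ ∫⁻ _, ENNReal.ofReal ρ ∂unif := lintegral_mono hsec
      _ = _ := by simp
  have hmarkov := mul_meas_ge_le_lintegral (μ := P) (measurable_measure_prodMk_left hA (ν := unif))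
    (ENNReal.ofReal ε)
  have hsub : {z | d / 8 * κ < ‖meanResidual n z‖ ^ 2 ∧
      ε ≤ unif.real {x | t < |rfsFit n z x - fourierFit n B q x|}} ⊆
      {z | ENNReal.ofReal ε ≤ unif (Prod.mk z ⁻¹' A)} := by
    rintro z ⟨h1, h2⟩
    refine ENNReal.ofReal_le_of_le_toReal (h2.trans (measureReal_mono ?_))
    intro x hx
    refine ⟨h1, ?_⟩
    rw [hGfit z x h1]
    exact hx
  have hfin : ENNReal.ofReal ε * P {z | ENNReal.ofReal ε ≤ unif (Prod.mk z ⁻¹' A)}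
      ≤ ENNReal.ofReal ρ := hmarkov.trans htot
  have hreal := ENNReal.toReal_le_of_le_ofReal hρ0 hfin
  rw [ENNReal.toReal_mul, ENNReal.toReal_ofReal hε.le] at hreal
  refine (measureReal_mono hsub).trans ?_
  rw [le_div_iff₀ hε, mul_comm]
  exact hreal

end Error

/-! ### The Dirichlet-type kernel and aliasing on the training grid -/

/-- The sum `cos u + cos (2 u) + … + cos (M u)`. -/
noncomputable def cosSum (M : ℕ) (u : ℝ) : ℝ := ∑ m ∈ Finset.range M, Real.cos ((m + 1 : ℕ) * u)

lemma cosSum_mul_sin (M : ℕ) (u : ℝ) :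
    2 * Real.sin (u / 2) * cosSum M u = Real.sin ((2 * M + 1) * (u / 2)) - Real.sin (u / 2) := by
  induction M with
  | zero => simp [cosSum]
  | succ M ih =>
    have h : 2 * Real.sin (u / 2) * Real.cos ((M + 1 : ℕ) * u)
        = Real.sin ((2 * (M + 1 : ℕ) + 1) * (u / 2)) - Real.sin ((2 * M + 1) * (u / 2)) := by
      have e1 : (2 * ((M + 1 : ℕ) : ℝ) + 1) * (u / 2) = (M + 1 : ℕ) * u + u / 2 := by ring
      have e2 : (2 * (M : ℝ) + 1) * (u / 2) = (M + 1 : ℕ) * u - u / 2 := by push_cast; ring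
      rw [e1, e2, Real.sin_add, Real.sin_sub]
      ring
    rw [cosSum, Finset.sum_range_succ, mul_add, h, ← cosSum, ih]
    ring

lemma cosSum_periodic (M : ℕ) : Function.Periodic (cosSum M) (2 * Real.pi) := by
  intro u
  unfold cosSum
  refine Finset.sum_congr rfl fun m _ => ?_
  rw [mul_add, Real.cos_add_nat_mul_two_pi]

lemma continuous_cosSum (M : ℕ) : Continuous (cosSum M) := by
  unfold cosSum
  fun_prop

section TrainingSums

variable {n : ℕ}

/-- A geometric sum over `n`-th roots of unity; the sign `(-1)^k` comes from the grid starting at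
the endpoint `-1`. -/
lemma sum_exp_trainPoint (hn : 0 < n) (k : ℕ) :
    ∑ i : Fin n, Complex.exp (((k * Real.pi * trainPoint n i : ℝ) : ℂ) * Complex.I)
      = if n ∣ k then (n : ℂ) * (-1) ^ k else 0 := by
  have hn' : (n : ℂ) ≠ 0 := by exact_mod_cast hn.ne'
  set ω : ℂ := Complex.exp (2 * Real.pi * Complex.I / n) with hω
  have hprim : IsPrimitiveRoot ω n := Complex.isPrimitiveRoot_exp n hn.ne'
  have hneg : Complex.exp (-(k * (Real.pi * Complex.I))) = (-1) ^ k := by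
    rw [← mul_neg, Complex.exp_nat_mul, Complex.exp_neg, Complex.exp_pi_mul_I]
    norm_num
  have hterm : ∀ i : Fin n, Complex.exp (((k * Real.pi * trainPoint n i : ℝ) : ℂ) * Complex.I)
      = (-1) ^ k * (ω ^ k) * (ω ^ k) ^ (i : ℕ) := by
    intro i
    rw [mul_assoc ((-1 : ℂ) ^ k), ← pow_succ', ← hneg, ← pow_mul, hω, ← Complex.exp_nat_mul, ← Complex.exp_add]
    congr 1
    simp only [trainPoint]
    push_cast
    field_simp
  simp_rw [hterm]
  rw [← Finset.mul_sum, Fin.sum_univ_eq_sum_range (fun i => (ω ^ k) ^ i) n]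
  split_ifs with h
  · rw [(hprim.pow_eq_one_iff_dvd k).2 h]
    simp [mul_comm]
  · have h1 : ω ^ k ≠ 1 := fun h0 => h ((hprim.pow_eq_one_iff_dvd k).1 h0)
    rw [geom_sum_eq h1, ← pow_mul, mul_comm k n, pow_mul, hprim.pow_eq_one]
    simp

lemma sum_cos_trainPoint (hn : 0 < n) (k : ℕ) :
    ∑ i : Fin n, Real.cos (k * Real.pi * trainPoint n i) = if n ∣ k then (n : ℝ) * (-1) ^ k else 0 := by
  have h := congrArg Complex.re (sum_exp_trainPoint hn k)
  rw [Complex.re_sum] at h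
  simp_rw [Complex.exp_ofReal_mul_I_re] at h
  rw [h]
  split_ifs
  · have : ((n : ℂ) * (-1) ^ k) = ((n * (-1) ^ k : ℝ) : ℂ) := by push_cast; rfl
    rw [this, Complex.ofReal_re]
  · simp

lemma sum_sin_trainPoint (hn : 0 < n) (k : ℕ) :
    ∑ i : Fin n, Real.sin (k * Real.pi * trainPoint n i) = 0 := by
  have h := congrArg Complex.im (sum_exp_trainPoint hn k)
  rw [Complex.im_sum] at h
  simp_rw [Complex.exp_ofReal_mul_I_im] at h
  rw [h]
  split_ifs
  · have : ((n : ℂ) * (-1) ^ k) = ((n * (-1) ^ k : ℝ) : ℂ) := by push_cast; rfl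
    rw [this, Complex.ofReal_im]
  · simp

end TrainingSums

section MeanFeature

variable {n B : ℕ}

/-- The Fourier basis functions, indexed by all natural numbers. -/
noncomputable def fourierBasis (j : ℕ) (x : ℝ) : ℝ :=
  if j = 0 then 1 / Real.sqrt 2
  else if j % 2 = 1 then Real.sin (((j + 1) / 2 : ℕ) * Real.pi * x)
  else Real.cos ((j / 2 : ℕ) * Real.pi * x)

lemma fourierFeature_apply (x : ℝ) (j : Fin B) : fourierFeature B x j = fourierBasis j x := rfl

lemma meanFeature_apply (j : Fin B) :
    meanFeature n B j = (n : ℝ)⁻¹ * ∑ i : Fin n, fourierBasis j (trainPoint n i) := by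
  simp [meanFeature, fourierFeature_apply]

/-- The frequencies that are visible on the training points are the multiples of `n`. -/
lemma mean_fourierBasis_mul (hn : 0 < n) (j : ℕ) (hj : j ≠ 0) (x : ℝ) :
    ((n : ℝ)⁻¹ * ∑ i : Fin n, fourierBasis j (trainPoint n i)) * fourierBasis j x
      = if 2 * n ∣ j then Real.cos ((j / (2 * n) : ℕ) * (n * Real.pi * (x + 1))) else 0 := by
  have hn' : (n : ℝ) ≠ 0 := by positivity
  unfold fourierBasis
  simp only [hj, if_false]
  rcases Nat.mod_two_eq_zero_or_one j with h | h
  · obtain ⟨k, rfl⟩ : ∃ k, j = 2 * k := ⟨j / 2, by omega⟩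
    have e : 2 * k / 2 = k := by omega
    simp only [h, zero_ne_one, if_false, e]
    rw [sum_cos_trainPoint hn]
    have hdvd : 2 * n ∣ 2 * k ↔ n ∣ k := Nat.mul_dvd_mul_iff_left (by norm_num)
    simp only [hdvd]
    split_ifs with hk
    · obtain ⟨m, rfl⟩ := hk
      have e2 : 2 * (n * m) / (2 * n) = m := by
        rw [← mul_assoc]
        exact Nat.mul_div_cancel_left _ (by omega)
      rw [e2, inv_mul_cancel_left₀ hn']
      -- The shift `x + 1` absorbs the sign `(-1)^(nm)` of the mean.
      have e3 : (m : ℝ) * (n * Real.pi * (x + 1)) = (n * m : ℕ) * Real.pi * x + (n * m : ℕ) * Real.pi := by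
        push_cast; ring
      rw [e3, Real.cos_add_nat_mul_pi]
    · simp
  · have h2 : ¬ 2 * n ∣ j := fun hd => by
      have := Nat.dvd_trans ⟨n, rfl⟩ hd
      omega
    simp only [h, if_true, h2, if_false]
    rw [sum_sin_trainPoint hn]
    simp

/-- The common weight of the nonconstant features. -/
noncomputable def oscWeight (n B : ℕ) (q : ℝ) : ℝ :=
  (1 - (n : ℝ) ^ (-q)) * B / ((B : ℝ) - 1)

lemma mean_bilevelSigma_feature (hn : 0 < n) (hB : 0 < B) (q x : ℝ) :
    meanFeature n B ⬝ᵥ bilevelSigma n B q *ᵥ fourierFeature B x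
      = (n : ℝ) ^ (-q) * B / 2
        + oscWeight n B q * cosSum ((B - 1) / 2 / n) (n * Real.pi * (x + 1)) := by
  set M := (B - 1) / 2 / n with hM
  have hn' : (n : ℝ) ≠ 0 := by positivity
  let f : ℕ → ℝ := fun j => (if j = 0 then (n : ℝ) ^ (-q) * B else oscWeight n B q)
    * (((n : ℝ)⁻¹ * ∑ i : Fin n, fourierBasis j (trainPoint n i)) * fourierBasis j x)
  have h1 : meanFeature n B ⬝ᵥ bilevelSigma n B q *ᵥ fourierFeature B x
      = ∑ j ∈ Finset.range B, f j := by
    rw [dotProduct_bilevelSigma, ← Fin.sum_univ_eq_sum_range]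
    refine Finset.sum_congr rfl fun j _ => ?_
    rw [meanFeature_apply, fourierFeature_apply, mul_assoc]
    rfl
  have hf : ∀ j, j ≠ 0 → f j = oscWeight n B q * (if 2 * n ∣ j then
      Real.cos ((j / (2 * n) : ℕ) * (n * Real.pi * (x + 1))) else 0) := by
    intro j hj
    simp only [f, hj, if_false]
    rw [mean_fourierBasis_mul hn j hj]
  -- The surviving indices are the multiples `2nm ≤ B - 1`, that is `m ≤ M`; `m = 0` is the constant
  -- feature.
  have h2 : ∑ j ∈ Finset.range B, f j
      = ∑ j ∈ (Finset.range (M + 1)).image (fun m => 2 * n * m), f j := by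
    symm
    refine Finset.sum_subset ?_ ?_
    · intro j hj
      obtain ⟨m, hm, rfl⟩ := Finset.mem_image.1 hj
      rw [Finset.mem_range] at hm ⊢
      have : m ≤ (B - 1) / 2 / n := by omega
      rw [Nat.div_div_eq_div_mul, Nat.le_div_iff_mul_le (by omega)] at this
      have e : m * (2 * n) = 2 * n * m := by ring
      omega
    · intro j hj hj2
      have hj0 : j ≠ 0 := by
        rintro rfl
        exact hj2 (Finset.mem_image.2 ⟨0, by simp, by simp⟩)
      rw [hf j hj0, if_neg, mul_zero]
      rintro ⟨m, rfl⟩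
      refine hj2 (Finset.mem_image.2 ⟨m, ?_, rfl⟩)
      rw [Finset.mem_range] at hj ⊢
      have : m ≤ (B - 1) / 2 / n := by
        rw [Nat.div_div_eq_div_mul, Nat.le_div_iff_mul_le (by omega)]
        have e : m * (2 * n) = 2 * n * m := by ring
        omega
      omega
  have hs : Real.sqrt 2 * Real.sqrt 2 = 2 := Real.mul_self_sqrt (by norm_num)
  rw [h1, h2, Finset.sum_image (by
    intro a _ b _ hab
    have hab' : 2 * n * a = 2 * n * b := hab
    exact Nat.eq_of_mul_eq_mul_left (by omega) hab'), Finset.sum_range_succ', add_comm]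
  congr 1
  · simp only [f, mul_zero, if_true, fourierBasis]
    simp only [Finset.sum_const, Finset.card_univ, Fintype.card_fin, nsmul_eq_mul]
    rw [inv_mul_cancel_left₀ hn', div_mul_div_comm, hs]
    ring
  · rw [cosSum, Finset.mul_sum]
    refine Finset.sum_congr rfl fun m _ => ?_
    rw [hf _ (by positivity), if_pos ⟨_, rfl⟩, Nat.mul_div_cancel_left _ (by omega)]

lemma cosSum_trainPoint (hn : 0 < n) (M : ℕ) (i : Fin n) :
    cosSum M (n * Real.pi * (trainPoint n i + 1)) = M := by
  have hn' : (n : ℝ) ≠ 0 := by positivity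
  have : ∀ m : ℕ, Real.cos ((m + 1 : ℕ) * (n * Real.pi * (trainPoint n i + 1))) = 1 := by
    intro m
    have e : ((m + 1 : ℕ) : ℝ) * (n * Real.pi * (trainPoint n i + 1))
        = (((m + 1) * (i + 1) : ℕ) : ℝ) * (2 * Real.pi) := by
      simp only [trainPoint]
      push_cast
      field_simp
      ring
    rw [e, Real.cos_nat_mul_two_pi]
  simp only [cosSum, this, Finset.sum_const, Finset.card_range, nsmul_eq_mul, mul_one]

/-- The weighted product of the mean feature with each training feature. -/
noncomputable def meanWeight (n B : ℕ) (q : ℝ) : ℝ :=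
  (n : ℝ) ^ (-q) * B / 2 + oscWeight n B q * ((B - 1) / 2 / n : ℕ)

lemma mean_bilevelSigma_trainPoint (hn : 0 < n) (hB : 0 < B) (q : ℝ) (i : Fin n) :
    meanFeature n B ⬝ᵥ bilevelSigma n B q *ᵥ fourierFeature B (trainPoint n i)
      = meanWeight n B q := by
  rw [mean_bilevelSigma_feature hn hB, cosSum_trainPoint hn, meanWeight]

lemma rpow_neg_lt_one (hn : 2 ≤ n) {q : ℝ} (hq : 0 < q) : (n : ℝ) ^ (-q) < 1 :=
  Real.rpow_lt_one_of_one_lt_of_neg (by exact_mod_cast hn) (by linarith)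

lemma oscWeight_pos (hn : 2 ≤ n) (hB : 2 ≤ B) {q : ℝ} (hq : 0 < q) : 0 < oscWeight n B q := by
  have h1 := rpow_neg_lt_one hn hq
  have h2 : (2 : ℝ) ≤ B := by exact_mod_cast hB
  unfold oscWeight
  have : 0 < 1 - (n : ℝ) ^ (-q) := by linarith
  have : 0 < (B : ℝ) - 1 := by linarith
  positivity

lemma bilevelWeight_pos (hn : 2 ≤ n) (hB : 2 ≤ B) {q : ℝ} (hq : 0 < q) (j : Fin B) :
    0 < bilevelWeight n B q j := by
  unfold bilevelWeight
  split_ifs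
  · have : (0 : ℝ) < n := by positivity
    positivity
  · exact oscWeight_pos hn hB hq

lemma feature_bilevelSigma_feature_le (hn : 2 ≤ n) (hB : 2 ≤ B) {q : ℝ} (hq : 0 < q) (x : ℝ) :
    fourierFeature B x ⬝ᵥ bilevelSigma n B q *ᵥ fourierFeature B x ≤ B := by
  have hB' : (2 : ℝ) ≤ B := by exact_mod_cast hB
  have hsq : ∀ j : Fin B, fourierFeature B x j ^ 2 ≤ 1 := by
    intro j
    rw [fourierFeature_apply, fourierBasis]
    split_ifs
    · rw [div_pow, Real.sq_sqrt (by norm_num)]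
      norm_num
    · exact Real.sin_sq_le_one _
    · exact Real.cos_sq_le_one _
  calc _ = ∑ j, bilevelWeight n B q j * fourierFeature B x j ^ 2 := by
        rw [dotProduct_bilevelSigma]
        exact Finset.sum_congr rfl fun j _ => by ring
    _ ≤ ∑ j, bilevelWeight n B q j := by
        refine Finset.sum_le_sum fun j _ => ?_
        exact mul_le_of_le_one_right (bilevelWeight_pos hn hB hq j).le (hsq j)
    -- The weights are normalized to have trace `B`.
    _ = B := by
        obtain ⟨b, rfl⟩ : ∃ b, B = b + 1 := ⟨B - 1, by omega⟩
        rw [Fin.sum_univ_succ]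
        simp only [bilevelWeight, Fin.val_zero, if_true, Fin.val_succ, Nat.succ_ne_zero, if_false,
          Finset.sum_const, Finset.card_univ, Fintype.card_fin, nsmul_eq_mul]
        push_cast at hB' ⊢
        have : (b : ℝ) ≠ 0 := by linarith
        rw [add_sub_cancel_right]
        field_simp
        ring

end MeanFeature

/-! ### Level sets of the sine -/

/-- The indicator function of the nonpositive reals. -/
noncomputable def negStep (y : ℝ) : ℝ := if y ≤ 0 then 1 else 0

lemma negStep_nonneg (y : ℝ) : 0 ≤ negStep y := by unfold negStep; split_ifs <;> norm_num

lemma negStep_le_one (y : ℝ) : negStep y ≤ 1 := by unfold negStep; split_ifs <;> norm_num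

lemma negStep_antitone : Antitone negStep := by
  intro a b h
  unfold negStep
  split_ifs <;> linarith

lemma measurable_negStep : Measurable negStep :=
  Measurable.ite measurableSet_Iic measurable_const measurable_const

lemma continuousAt_negStep {y : ℝ} (hy : y ≠ 0) : ContinuousAt negStep y := by
  rcases lt_or_gt_of_ne hy with h | h
  · refine (continuousAt_const (y := (1 : ℝ))).congr ?_
    filter_upwards [Iio_mem_nhds h] with x hx
    have : x < 0 := hx
    rw [negStep, if_pos this.le]
  · refine (continuousAt_const (y := (0 : ℝ))).congr ?_
    filter_upwards [Ioi_mem_nhds h] with x hx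
    have : 0 < x := hx
    rw [negStep, if_neg this.not_ge]

lemma intervalIntegrable_of_measurable_of_le_one {f : ℝ → ℝ} (hf : Measurable f)
    (h0 : ∀ x, 0 ≤ f x) (h1 : ∀ x, f x ≤ 1) (a b : ℝ) : IntervalIntegrable f volume a b := by
  refine (intervalIntegrable_const (c := (1 : ℝ))).mono_fun hf.aestronglyMeasurable
    (ae_of_all _ fun x => ?_)
  simpa [abs_of_nonneg (h0 x)] using h1 x

lemma intervalIntegrable_negStep {F : ℝ → ℝ} (hF : Measurable F) (a b : ℝ) :
    IntervalIntegrable (fun x => negStep (F x)) volume a b :=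
  intervalIntegrable_of_measurable_of_le_one (measurable_negStep.comp hF)
    (fun _ => negStep_nonneg _) (fun _ => negStep_le_one _) a b

lemma unif_real_setOf_le_zero {F : ℝ → ℝ} (hF : Measurable F) :
    unif.real {x | F x ≤ 0} = 1 / 2 * ∫ x in (-1 : ℝ)..1, negStep (F x) := by
  have hS : MeasurableSet {x | F x ≤ 0} := measurableSet_le hF measurable_const
  have h1 : (fun x => negStep (F x)) = Set.indicator {x | F x ≤ 0} (fun _ => (1 : ℝ)) := by
    funext x
    by_cases h : F x ≤ 0
    · rw [Set.indicator_of_mem (show x ∈ {x | F x ≤ 0} from h), negStep, if_pos h]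
    · rw [Set.indicator_of_notMem (show x ∉ {x | F x ≤ 0} from h), negStep, if_neg h]
  rw [h1, intervalIntegral.integral_of_le (by norm_num), ← integral_Icc_eq_integral_Ioc,
    integral_indicator_const _ hS, measureReal_restrict_apply hS, unif, Measure.real,
    cond_apply measurableSet_Icc, ENNReal.toReal_mul, Real.volume_Icc, Set.inter_comm]
  norm_num [Measure.real]

section SineLevel

/-- The measure of the points of a period at which the sine is at most `y`. -/
noncomputable def sineLevel (y : ℝ) : ℝ := ∫ s in (0 : ℝ)..2 * Real.pi, negStep (Real.sin s - y)

lemma volume_sin_eq (y : ℝ) : volume {s : ℝ | Real.sin s = y} = 0 := by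
  refine Set.Countable.measure_zero ?_ _
  rcases Set.eq_empty_or_nonempty {s : ℝ | Real.sin s = y} with h | ⟨a, ha⟩
  · rw [h]
    exact Set.countable_empty
  · have ha' : Real.sin a = y := ha
    refine ((Set.countable_range fun k : ℤ => 2 * k * Real.pi + a).union
      (Set.countable_range fun k : ℤ => (2 * k + 1) * Real.pi - a)).mono ?_
    intro s hs
    have hs' : Real.sin a = Real.sin s := by rw [ha']; exact (show Real.sin s = y from hs).symm
    obtain ⟨k, hk | hk⟩ := Real.sin_eq_sin_iff.1 hs'
    · exact Or.inl ⟨k, hk.symm⟩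
    · exact Or.inr ⟨k, hk.symm⟩

/-- Dominated convergence: the integrand is continuous in `y` except where `sin s = y`, a countable
set. -/
lemma continuous_sineLevel : Continuous sineLevel := by
  rw [continuous_iff_continuousAt]
  intro y
  refine intervalIntegral.continuousAt_of_dominated_interval (bound := fun _ => 1) ?_ ?_ ?_ ?_
  · exact Eventually.of_forall fun y' =>
      (measurable_negStep.comp (by fun_prop : Measurable fun s => Real.sin s - y')).aestronglyMeasurable
  · refine Eventually.of_forall fun y' => ae_of_all _ fun s _ => ?_
    rw [Real.norm_of_nonneg (negStep_nonneg _)]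
    exact negStep_le_one _
  · exact intervalIntegrable_const
  · have : ∀ᵐ s : ℝ, Real.sin s ≠ y := by
      rw [ae_iff]
      simpa using volume_sin_eq y
    filter_upwards [this] with s hs _
    exact ContinuousAt.comp (f := fun y' => Real.sin s - y') (g := negStep)
      (continuousAt_negStep (sub_ne_zero.2 hs)) (by fun_prop)

lemma integral_negStep_sin_add (y a : ℝ) :
    ∫ s in (0 : ℝ)..2 * Real.pi, negStep (Real.sin (a + s) - y) = sineLevel y := by
  have hper : Function.Periodic (fun s => negStep (Real.sin s - y)) (2 * Real.pi) := fun s => by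
    simp only [Real.sin_add_two_pi]
  have h := hper.intervalIntegral_add_eq a 0
  rw [intervalIntegral.integral_comp_add_left (fun s => negStep (Real.sin s - y)), add_zero, h,
    zero_add, sineLevel]

end SineLevel

/-! ### Equidistribution of the fast phase -/

section Oscillation

/-- The measure of the set where a fast sine is at most a multiple of a slow sine. -/
noncomputable def sineRatioLevel (N b : ℝ) : ℝ :=
  ∫ v in (0 : ℝ)..Real.pi, negStep (Real.sin (N * v) - b * Real.sin v)

/-- The mean over a fast phase of the level sets of the sine below `b sin v + ε`. -/
noncomputable def averagedLevel (b ε : ℝ) : ℝ :=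
  ∫ v in (0 : ℝ)..Real.pi, sineLevel (b * Real.sin v + ε)

lemma continuous_averagedLevel (b : ℝ) : Continuous (averagedLevel b) := by
  unfold averagedLevel
  refine intervalIntegral.continuous_parametric_intervalIntegral_of_continuous' ?_ _ _
  have := continuous_sineLevel
  unfold Function.uncurry
  fun_prop

lemma integral_integral_negStep (N b ε : ℝ) :
    ∫ s in (0 : ℝ)..2 * Real.pi, ∫ v in (0 : ℝ)..Real.pi,
      negStep (Real.sin (N * v + s) - (b * Real.sin v + ε)) = averagedLevel b ε := by
  rw [intervalIntegral_intervalIntegral_swap]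
  · simp_rw [integral_negStep_sin_add]
    rfl
  · rw [IntegrableOn, Measure.volume_eq_prod, ← Measure.prod_restrict]
    rw [Set.uIoc_of_le Real.two_pi_pos.le, Set.uIoc_of_le Real.pi_pos.le]
    refine Integrable.of_bound (C := 1) ?_ (ae_of_all _ fun p => ?_)
    · exact (measurable_negStep.comp (by fun_prop : Measurable fun p : ℝ × ℝ =>
        Real.sin (N * p.2 + p.1) - (b * Real.sin p.2 + ε))).aestronglyMeasurable
    · simp only [Function.uncurry]
      rw [Real.norm_of_nonneg (negStep_nonneg _)]
      exact negStep_le_one _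

/-- Shifting `v` by `s/N` advances the fast phase by `s` and only exchanges two end pieces of length
`s/N`. -/
lemma abs_sineRatioLevel_sub_shift_le {N : ℝ} (hN : 0 < N) (β : ℝ) {s : ℝ} (hs0 : 0 ≤ s)
    (hs : s ≤ 2 * Real.pi) :
    |sineRatioLevel N β - ∫ v in (0 : ℝ)..Real.pi,
      negStep (Real.sin (N * v + s) - β * Real.sin (v + s / N))| ≤ 2 * Real.pi / N := by
  set f : ℝ → ℝ := fun v => negStep (Real.sin (N * v) - β * Real.sin v) with hf
  have hfm : Measurable fun v => Real.sin (N * v) - β * Real.sin v := by fun_prop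
  have hint : ∀ a b, IntervalIntegrable f volume a b := intervalIntegrable_negStep hfm
  have h1 : ∫ v in (0 : ℝ)..Real.pi, negStep (Real.sin (N * v + s) - β * Real.sin (v + s / N))
      = ∫ v in (0 + s / N)..(Real.pi + s / N), f v := by
    rw [← intervalIntegral.integral_comp_add_right]
    refine intervalIntegral.integral_congr fun v _ => ?_
    simp only [hf]
    rw [mul_add, mul_div_cancel₀ _ hN.ne']
  have hsN : 0 ≤ s / N := by positivity
  have hshort : ∀ a, 0 ≤ ∫ v in a..(a + s / N), f v ∧ ∫ v in a..(a + s / N), f v ≤ s / N := by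
    intro a
    refine ⟨intervalIntegral.integral_nonneg (by linarith) fun v _ => negStep_nonneg _, ?_⟩
    calc _ ≤ ∫ v in a..(a + s / N), (1 : ℝ) :=
          intervalIntegral.integral_mono_on (by linarith) (hint _ _) intervalIntegrable_const
            fun v _ => negStep_le_one _
      _ = s / N := by simp
  have h2 : (∫ v in (0 : ℝ)..Real.pi, f v) + ∫ v in Real.pi..(Real.pi + s / N), f v
      = (∫ v in (0 : ℝ)..(0 + s / N), f v) + ∫ v in (0 + s / N)..(Real.pi + s / N), f v := by
    rw [intervalIntegral.integral_add_adjacent_intervals (hint _ _) (hint _ _),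
      intervalIntegral.integral_add_adjacent_intervals (hint _ _) (hint _ _)]
  have h3 := hshort 0
  have h4 := hshort Real.pi
  have h5 : s / N ≤ 2 * Real.pi / N := by gcongr
  rw [h1, sineRatioLevel, abs_le]
  constructor <;> linarith [h3.1, h3.2, h4.1, h4.2]

lemma abs_mul_sin_shift_le {N : ℝ} (hN : 0 < N) (β b v : ℝ) {s : ℝ} (hs0 : 0 ≤ s)
    (hs : s ≤ 2 * Real.pi) :
    |β * Real.sin (v + s / N) - b * Real.sin v| ≤ 2 * Real.pi * |β| / N + |β - b| := by
  have h1 : |Real.sin (v + s / N) - Real.sin v| ≤ 2 * Real.pi / N := by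
    have := Real.abs_sin_sub_sin_le (v + s / N) v
    rw [add_sub_cancel_left, abs_of_nonneg (div_nonneg hs0 hN.le)] at this
    exact this.trans (by gcongr)
  have h2 : β * Real.sin (v + s / N) - b * Real.sin v
      = β * (Real.sin (v + s / N) - Real.sin v) + (β - b) * Real.sin v := by ring
  rw [h2]
  refine (abs_add_le _ _).trans ?_
  rw [abs_mul, abs_mul]
  have h3 := Real.abs_sin_le_one v
  have h4 : |β| * |Real.sin (v + s / N) - Real.sin v| ≤ |β| * (2 * Real.pi / N) := by gcongr
  have h5 : |β - b| * |Real.sin v| ≤ |β - b| * 1 := by gcongr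
  have h6 : |β| * (2 * Real.pi / N) = 2 * Real.pi * |β| / N := by ring
  linarith

/-- Average the shifted integral over a full phase `s`. The slow term moves by at most `δ`, so
monotonicity of `negStep` compares it with a fixed `b`, and the average over `s` is `averagedLevel`.
-/
lemma sineRatioLevel_bounds {N : ℝ} (hN : 0 < N) (β b : ℝ) :
    averagedLevel b (-(2 * Real.pi * |β| / N + |β - b|)) / (2 * Real.pi) - 2 * Real.pi / N
      ≤ sineRatioLevel N β ∧
    sineRatioLevel N β
      ≤ averagedLevel b (2 * Real.pi * |β| / N + |β - b|) / (2 * Real.pi) + 2 * Real.pi / N := by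
  set δ := 2 * Real.pi * |β| / N + |β - b| with hδ
  have hpi : 0 < 2 * Real.pi := by positivity
  have hmeas : ∀ s ε, Measurable fun v => Real.sin (N * v + s) - (b * Real.sin v + ε) :=
    fun s ε => by fun_prop
  have hmeas2 : ∀ s, Measurable fun v => Real.sin (N * v + s) - β * Real.sin (v + s / N) :=
    fun s => by fun_prop
  have hinner : ∀ ε, IntervalIntegrable (fun s => ∫ v in (0 : ℝ)..Real.pi,
      negStep (Real.sin (N * v + s) - (b * Real.sin v + ε))) volume 0 (2 * Real.pi) := by
    intro ε
    have hm : StronglyMeasurable fun s => ∫ v in (0 : ℝ)..Real.pi,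
        negStep (Real.sin (N * v + s) - (b * Real.sin v + ε)) := by
      simp_rw [intervalIntegral.integral_of_le Real.pi_pos.le]
      exact StronglyMeasurable.integral_prod_right' (f := fun p : ℝ × ℝ =>
        negStep (Real.sin (N * p.2 + p.1) - (b * Real.sin p.2 + ε)))
        (measurable_negStep.comp (by fun_prop : Measurable fun p : ℝ × ℝ =>
          Real.sin (N * p.2 + p.1) - (b * Real.sin p.2 + ε))).stronglyMeasurable
    refine (intervalIntegrable_const (c := Real.pi)).mono_fun hm.aestronglyMeasurable
      (ae_of_all _ fun s => ?_)
    change ‖∫ v in (0 : ℝ)..Real.pi, _‖ ≤ ‖Real.pi‖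
    rw [Real.norm_of_nonneg (intervalIntegral.integral_nonneg Real.pi_pos.le
      fun v _ => negStep_nonneg _), Real.norm_of_nonneg Real.pi_pos.le]
    calc _ ≤ ∫ v in (0 : ℝ)..Real.pi, (1 : ℝ) :=
          intervalIntegral.integral_mono_on Real.pi_pos.le (intervalIntegrable_negStep (hmeas s ε) _ _)
            intervalIntegrable_const fun v _ => negStep_le_one _
      _ = Real.pi := by simp
  have hconst : ∀ c : ℝ, ∫ _ in (0 : ℝ)..2 * Real.pi, c = 2 * Real.pi * c := by simp
  constructor
  · have h1 : averagedLevel b (-δ) ≤ 2 * Real.pi * (sineRatioLevel N β + 2 * Real.pi / N) := by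
      rw [← integral_integral_negStep N, ← hconst]
      refine intervalIntegral.integral_mono_on hpi.le (hinner _) intervalIntegrable_const
        fun s hs => ?_
      have h2 := (abs_le.1 (abs_sineRatioLevel_sub_shift_le hN β hs.1 hs.2)).1
      have h3 : ∫ v in (0 : ℝ)..Real.pi, negStep (Real.sin (N * v + s) - (b * Real.sin v + -δ))
          ≤ ∫ v in (0 : ℝ)..Real.pi, negStep (Real.sin (N * v + s) - β * Real.sin (v + s / N)) := by
        refine intervalIntegral.integral_mono_on Real.pi_pos.le
          (intervalIntegrable_negStep (hmeas s _) _ _) (intervalIntegrable_negStep (hmeas2 s) _ _)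
          fun v _ => negStep_antitone ?_
        have := (abs_le.1 (abs_mul_sin_shift_le hN β b v hs.1 hs.2)).1
        linarith
      linarith
    rw [sub_le_iff_le_add, div_le_iff₀ hpi]
    linarith
  · have h1 : 2 * Real.pi * (sineRatioLevel N β - 2 * Real.pi / N) ≤ averagedLevel b δ := by
      rw [← integral_integral_negStep N, ← hconst]
      refine intervalIntegral.integral_mono_on hpi.le intervalIntegrable_const (hinner _)
        fun s hs => ?_
      have h2 := (abs_le.1 (abs_sineRatioLevel_sub_shift_le hN β hs.1 hs.2)).2
      have h3 : ∫ v in (0 : ℝ)..Real.pi, negStep (Real.sin (N * v + s) - β * Real.sin (v + s / N))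
          ≤ ∫ v in (0 : ℝ)..Real.pi, negStep (Real.sin (N * v + s) - (b * Real.sin v + δ)) := by
        refine intervalIntegral.integral_mono_on Real.pi_pos.le
          (intervalIntegrable_negStep (hmeas2 s) _ _) (intervalIntegrable_negStep (hmeas s _) _ _)
          fun v _ => negStep_antitone ?_
        have := (abs_le.1 (abs_mul_sin_shift_le hN β b v hs.1 hs.2)).2
        linarith
      linarith
    rw [← sub_le_iff_le_add, le_div_iff₀ hpi]
    linarith

lemma tendsto_sineRatioLevel {N β : ℕ → ℝ} {b : ℝ} (hN : Tendsto N atTop atTop)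
    (hβ : Tendsto β atTop (𝓝 b)) :
    Tendsto (fun n => sineRatioLevel (N n) (β n)) atTop
      (𝓝 (averagedLevel b 0 / (2 * Real.pi))) := by
  have h0 : Tendsto (fun n => 2 * Real.pi * |β n| / N n + |β n - b|) atTop (𝓝 0) := by
    have h1 : Tendsto (fun n => 2 * Real.pi * |β n| / N n) atTop (𝓝 0) :=
      (hβ.abs.const_mul (2 * Real.pi)).div_atTop hN
    have h2 : Tendsto (fun n => |β n - b|) atTop (𝓝 0) := by
      simpa using (hβ.sub_const b).abs
    simpa using h1.add h2
  have h3 : Tendsto (fun n => 2 * Real.pi / N n) atTop (𝓝 0) := hN.const_div_atTop _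
  have hc := (continuous_averagedLevel b).tendsto 0
  have hup := ((hc.comp h0).div_const (2 * Real.pi)).add h3
  have hlo := ((hc.comp (by simpa using h0.neg)).div_const (2 * Real.pi)).sub h3
    (f := fun n => averagedLevel b (-(2 * Real.pi * |β n| / N n + |β n - b|)) / (2 * Real.pi))
  rw [add_zero] at hup
  rw [sub_zero] at hlo
  refine tendsto_of_tendsto_of_tendsto_of_le_of_le' hlo hup ?_ ?_
  · filter_upwards [hN.eventually_gt_atTop 0] with n hn
    exact (sineRatioLevel_bounds hn (β n) b).1
  · filter_upwards [hN.eventually_gt_atTop 0] with n hn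
    exact (sineRatioLevel_bounds hn (β n) b).2

/-- For fixed `v` inside `(0, π)`, `β sin v` eventually lies below `-1` and the inequality fails. -/
lemma tendsto_sineRatioLevel_atBot {N β : ℕ → ℝ} (hβ : Tendsto β atTop atBot) :
    Tendsto (fun n => sineRatioLevel (N n) (β n)) atTop (𝓝 0) := by
  have : (0 : ℝ) = ∫ v in (0 : ℝ)..Real.pi, (0 : ℝ) := by simp
  rw [this]
  refine intervalIntegral.tendsto_integral_filter_of_dominated_convergence (fun _ => 1) ?_ ?_ ?_ ?_
  · exact Eventually.of_forall fun n => (measurable_negStep.comp (by fun_prop :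
      Measurable fun v => Real.sin (N n * v) - β n * Real.sin v)).aestronglyMeasurable
  · refine Eventually.of_forall fun n => ae_of_all _ fun v _ => ?_
    rw [Real.norm_of_nonneg (negStep_nonneg _)]
    exact negStep_le_one _
  · exact intervalIntegrable_const
  · have hne : ∀ᵐ v : ℝ, v ≠ Real.pi := by
      rw [ae_iff]
      simp
    filter_upwards [hne] with v hv hv'
    rw [Set.uIoc_of_le Real.pi_pos.le] at hv'
    have hsin : 0 < Real.sin v := Real.sin_pos_of_pos_of_lt_pi hv'.1 (lt_of_le_of_ne hv'.2 hv)
    refine tendsto_const_nhds.congr' ?_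
    filter_upwards [hβ.eventually_lt_atBot (-(1 / Real.sin v))] with n hn
    rw [negStep, if_neg]
    have h1 : β n * Real.sin v < -1 := by
      have := mul_lt_mul_of_pos_right hn hsin
      rwa [neg_mul, one_div, inv_mul_cancel₀ hsin.ne'] at this
    have h2 := Real.neg_one_le_sin (N n * v)
    linarith

end Oscillation

/-! ### Risks as sublevel sets, and the explicit Fourier fit -/

lemma sign_ne_sign_fstar_iff (y x : ℝ) :
    SignType.sign y ≠ SignType.sign (fstar x) ↔ y ≤ 0 := by
  have h : SignType.sign (fstar x) = 1 := sign_pos (by simp [fstar])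
  rw [h, Ne, sign_eq_one_iff, not_lt]

lemma classRisk_eq (f : ℝ → ℝ) : classRisk f = unif.real {x | f x ≤ 0} := by
  unfold classRisk
  simp_rw [sign_ne_sign_fstar_iff]

/-- Closeness at most points makes the classification risk close to sublevel probabilities. -/
lemma classRisk_bounds (f g : ℝ → ℝ) (t : ℝ) :
    classRisk g ≤ unif.real {x | f x ≤ t} + unif.real {x | t < |g x - f x|} ∧
    unif.real {x | f x ≤ -t} - unif.real {x | t < |g x - f x|} ≤ classRisk g := by
  rw [classRisk_eq]
  constructor
  · refine le_trans (measureReal_mono ?_) (measureReal_union_le _ _)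
    intro x hx
    have hx' : g x ≤ 0 := hx
    by_cases h : t < |g x - f x|
    · exact Or.inr h
    · refine Or.inl (show f x ≤ t from ?_)
      have := neg_abs_le (g x - f x)
      linarith [not_lt.1 h]
  · rw [sub_le_iff_le_add]
    refine le_trans (measureReal_mono ?_) (measureReal_union_le _ _)
    intro x hx
    have hx' : f x ≤ -t := hx
    by_cases h : t < |g x - f x|
    · exact Or.inr h
    · refine Or.inl (show g x ≤ 0 from ?_)
      have := le_abs_self (g x - f x)
      linarith [not_lt.1 h]

/-- If every point of `[-1, 1]` has a misclassified point within `ε`, the adversarial risk is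
maximal. -/
lemma advRisk_eq_one {f : ℝ → ℝ} {ε : ℝ}
    (h : ∀ x ∈ Set.Icc (-1 : ℝ) 1, ∃ x', |x' - x| ≤ ε ∧ f x' ≤ 0) : advRisk f ε = 1 := by
  have hae : ∀ᵐ x ∂unif, x ∈ Set.Icc (-1 : ℝ) 1 := ae_cond_mem measurableSet_Icc
  have : advRisk f ε = ∫ x, (1 : ℝ) ∂unif := by
    refine integral_congr_ae ?_
    filter_upwards [hae] with x hx
    obtain ⟨x', hx', hf⟩ := h x hx
    have hle : ∀ y : {x' : ℝ // |x' - x| ≤ ε},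
        Set.indicator {t : ℝ | SignType.sign (f t) ≠ SignType.sign (fstar x)}
          (fun _ => (1 : ℝ)) (y : ℝ) ≤ 1 := fun y =>
      Set.indicator_apply_le' (fun _ => le_rfl) (fun _ => zero_le_one)
    refine le_antisymm ?_ ?_
    · have : Nonempty {x' : ℝ // |x' - x| ≤ ε} := ⟨⟨x', hx'⟩⟩
      exact ciSup_le hle
    · refine le_trans (le_of_eq ?_) (le_ciSup ⟨1, ?_⟩ ⟨x', hx'⟩)
      · exact (Set.indicator_of_mem (show x' ∈ {t : ℝ | SignType.sign (f t) ≠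
          SignType.sign (fstar x)} from (sign_ne_sign_fstar_iff _ _).2 hf) (fun _ => (1 : ℝ))).symm
      · rintro _ ⟨y, rfl⟩
        exact hle y
  rw [this]
  simp

section FourierFit

variable {n B : ℕ} {q : ℝ}

lemma meanWeight_pos (hn : 2 ≤ n) (hB : 2 ≤ B) (hq : 0 < q) : 0 < meanWeight n B q := by
  have h1 := oscWeight_pos hn hB hq
  have : (0 : ℝ) < n := by positivity
  unfold meanWeight
  positivity

lemma fourierFit_eq (hn : 2 ≤ n) (hB : 2 ≤ B) (hq : 0 < q) (x : ℝ) :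
    fourierFit n B q x = ((n : ℝ) ^ (-q) * B / 2
      + oscWeight n B q * cosSum ((B - 1) / 2 / n) (n * Real.pi * (x + 1))) / meanWeight n B q := by
  rw [(fourier_interpolation (bilevelWeight_pos hn hB hq) (meanWeight_pos hn hB hq).ne'
    (mean_bilevelSigma_trainPoint (by omega) (by omega) q)).2 x,
    mean_bilevelSigma_feature (by omega) (by omega)]

/-- Averages over `[-1, 1]` of a function of `n` full periods reduce to one period. -/
lemma integral_periodic_rescale (hn : 0 < n) {g : ℝ → ℝ} (hg : Function.Periodic g (2 * Real.pi))
    (hint : ∀ a b, IntervalIntegrable g volume a b) :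
    ∫ x in (-1 : ℝ)..1, g (n * Real.pi * (x + 1))
      = 2 / Real.pi * ∫ v in (0 : ℝ)..Real.pi, g (2 * v) := by
  have hn' : (n : ℝ) ≠ 0 := by positivity
  have hpi := Real.pi_ne_zero
  have e : ∀ x : ℝ, g (n * Real.pi * (x + 1)) = g (n * Real.pi * x + n * Real.pi) := fun x => by
    ring_nf
  simp_rw [e]
  rw [intervalIntegral.integral_comp_mul_add _ (by positivity) (n * Real.pi),
    intervalIntegral.integral_comp_mul_left _ (by norm_num : (2 : ℝ) ≠ 0)]
  have h1 : (n : ℝ) * Real.pi * -1 + n * Real.pi = 0 := by ring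
  have h2 : (n : ℝ) * Real.pi * 1 + n * Real.pi = 0 + (n : ℤ) • (2 * Real.pi) := by
    simp only [zsmul_eq_mul, Int.cast_natCast]
    ring
  rw [h1, h2, hg.intervalIntegral_add_zsmul_eq n 0 hint]
  simp only [zsmul_eq_mul, Int.cast_natCast, zero_add, mul_zero, smul_eq_mul]
  field_simp

/-- Sublevel probabilities of the Fourier fit in terms of two sines. -/
lemma unif_fourierFit_le (hn : 2 ≤ n) (hB : 2 ≤ B) (hq : 0 < q) (t : ℝ) :
    unif.real {x | fourierFit n B q x ≤ t} = 1 / Real.pi *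
      sineRatioLevel (2 * ((B - 1) / 2 / n : ℕ) + 1)
        (1 - ((n : ℝ) ^ (-q) * B - 2 * (t * meanWeight n B q)) / oscWeight n B q) := by
  set M := (B - 1) / 2 / n with hM
  set c := oscWeight n B q with hc
  set κ := meanWeight n B q with hκ
  set l := (n : ℝ) ^ (-q) * B with hl
  have hc0 : 0 < c := oscWeight_pos hn hB hq
  have hκ0 : 0 < κ := meanWeight_pos hn hB hq
  let F : ℝ → ℝ := fun u => l / 2 + c * cosSum M u - t * κ
  have hF : Measurable F := by
    have := (continuous_cosSum M).measurable
    fun_prop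
  have h1 : {x | fourierFit n B q x ≤ t} = {x | F (n * Real.pi * (x + 1)) ≤ 0} := by
    ext x
    change fourierFit n B q x ≤ t ↔ F (n * Real.pi * (x + 1)) ≤ 0
    rw [fourierFit_eq hn hB hq, div_le_iff₀ hκ0]
    exact sub_nonpos.symm
  rw [h1, unif_real_setOf_le_zero (F := fun x => F (n * Real.pi * (x + 1))) (hF.comp (by fun_prop)),
    integral_periodic_rescale (g := fun u => negStep (F u)) (by omega)
      (fun u => by simp only [F]; rw [cosSum_periodic M u]) (intervalIntegrable_negStep hF),
    sineRatioLevel, ← mul_assoc]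
  have h2 : ∫ v in (0 : ℝ)..Real.pi, negStep (F (2 * v)) = ∫ v in (0 : ℝ)..Real.pi,
      negStep (Real.sin ((2 * (M : ℕ) + 1) * v) - (1 - (l - 2 * (t * κ)) / c) * Real.sin v) := by
    refine intervalIntegral.integral_congr_ae ?_
    have hne : ∀ᵐ v : ℝ, v ≠ Real.pi := by
      rw [ae_iff]
      simp
    filter_upwards [hne] with v hv hv'
    rw [Set.uIoc_of_le Real.pi_pos.le] at hv'
    have hsin : 0 < Real.sin v := Real.sin_pos_of_pos_of_lt_pi hv'.1 (lt_of_le_of_ne hv'.2 hv)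
    have hD := cosSum_mul_sin M (2 * v)
    rw [mul_div_cancel_left₀ v (two_ne_zero : (2 : ℝ) ≠ 0)] at hD
    -- Clearing the denominator of the kernel multiplies by `2 sin v / c`, positive on `(0, π)`, so
    -- signs are kept.
    have hid : Real.sin ((2 * (M : ℕ) + 1) * v) - (1 - (l - 2 * (t * κ)) / c) * Real.sin v
        = 2 * Real.sin v / c * F (2 * v) := by
      simp only [F]
      field_simp
      linear_combination (-c) * hD
    rw [hid]
    have hpos : 0 < 2 * Real.sin v / c := by positivity
    unfold negStep
    simp only [mul_nonpos_iff, hpos.le, hpos.not_ge, true_and, false_and, or_false]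
  rw [h2]
  ring

end FourierFit

/-! ### Orders of magnitude of the weights and exponents -/

section Asymptotics

lemma tendsto_natCast_rpow {s : ℝ} (hs : 0 < s) :
    Tendsto (fun n : ℕ => (n : ℝ) ^ s) atTop atTop :=
  (tendsto_rpow_atTop hs).comp tendsto_natCast_atTop_atTop

lemma tendsto_natCast_rpow_neg {s : ℝ} (hs : s < 0) :
    Tendsto (fun n : ℕ => (n : ℝ) ^ s) atTop (𝓝 0) := by
  have := (tendsto_rpow_neg_atTop (y := -s) (by linarith)).comp tendsto_natCast_atTop_atTop
  simpa [Function.comp_def] using this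

lemma summable_pow_mul_exp_neg_rpow (k : ℕ) {a τ : ℝ} (ha : 0 < a) (hτ : 0 < τ) :
    Summable fun n : ℕ => (n : ℝ) ^ k * Real.exp (-(a * (n : ℝ) ^ τ)) := by
  have h1 := (isLittleO_exp_neg_mul_rpow_atTop ha (-((k + 2) / τ))).comp_tendsto
    (tendsto_natCast_rpow hτ)
  have h2 : (fun n : ℕ => Real.exp (-(a * (n : ℝ) ^ τ))) =O[atTop]
      fun n : ℕ => (n : ℝ) ^ (-((k : ℝ) + 2)) := by
    refine (h1.isBigO.congr' ?_ ?_)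
    · exact Eventually.of_forall fun n => by simp
    · exact Eventually.of_forall fun n => by
        simp only [Function.comp]
        rw [← Real.rpow_mul (Nat.cast_nonneg n)]
        congr 1
        field_simp
  have h3 := (Asymptotics.isBigO_refl (fun n : ℕ => (n : ℝ) ^ k) atTop).mul h2
  have h4 : Summable fun n : ℕ => (n : ℝ) ^ (-2 : ℝ) := Real.summable_nat_rpow.2 (by norm_num)
  refine summable_of_isBigO_nat h4 (h3.congr' EventuallyEq.rfl ?_)
  filter_upwards [eventually_gt_atTop 0] with n hn
  have hn' : (0 : ℝ) < n := by positivity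
  rw [← Real.rpow_natCast, ← Real.rpow_add hn']
  congr 1
  ring

variable {p q T : ℝ} {B d : ℕ → ℕ}

lemma eventually_rpow_bounds {s : ℝ} (hs : 0 < s) {A : ℕ → ℕ}
    (hA : ∀ n : ℕ, |(A n : ℝ) - (n : ℝ) ^ s| ≤ 1) :
    ∀ᶠ n : ℕ in atTop, (n : ℝ) ^ s / 2 ≤ A n ∧ (A n : ℝ) ≤ 2 * (n : ℝ) ^ s := by
  filter_upwards [(tendsto_natCast_rpow hs).eventually_ge_atTop 2] with n hn
  have := abs_le.1 (hA n)
  constructor <;> linarith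

lemma tendsto_div_rpow {s : ℝ} (hs : 0 < s) {A : ℕ → ℕ}
    (hA : ∀ n : ℕ, |(A n : ℝ) - (n : ℝ) ^ s| ≤ 1) :
    Tendsto (fun n : ℕ => (A n : ℝ) / (n : ℝ) ^ s) atTop (𝓝 1) := by
  have h1 : Tendsto (fun n : ℕ => ((A n : ℝ) - (n : ℝ) ^ s) / (n : ℝ) ^ s) atTop (𝓝 0) := by
    refine squeeze_zero_norm' (a := fun n : ℕ => 1 / (n : ℝ) ^ s) ?_
      ((tendsto_natCast_rpow hs).const_div_atTop 1)
    filter_upwards [(tendsto_natCast_rpow hs).eventually_gt_atTop 0] with n hn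
    rw [norm_div, Real.norm_eq_abs, Real.norm_of_nonneg hn.le]
    gcongr
    exact hA n
  have h2 := h1.add_const 1
  rw [zero_add] at h2
  refine h2.congr' ?_
  filter_upwards [(tendsto_natCast_rpow hs).eventually_gt_atTop 0] with n hn
  field_simp
  ring

lemma tendsto_atTop_of_rpow {s : ℝ} (hs : 0 < s) {A : ℕ → ℕ}
    (hA : ∀ n : ℕ, |(A n : ℝ) - (n : ℝ) ^ s| ≤ 1) :
    Tendsto (fun n : ℕ => (A n : ℝ)) atTop atTop := by
  refine tendsto_atTop_mono (fun n => ?_)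
    (tendsto_atTop_add_const_right atTop (-1) (tendsto_natCast_rpow hs))
  have := abs_le.1 (hA n)
  linarith

lemma tendsto_oscWeight (hp : 0 < p) (hq : 0 < q)
    (hB : ∀ n : ℕ, |(B n : ℝ) - (n : ℝ) ^ p| ≤ 1) :
    Tendsto (fun n => oscWeight n (B n) q) atTop (𝓝 1) := by
  have h1 : Tendsto (fun n : ℕ => 1 - (n : ℝ) ^ (-q)) atTop (𝓝 (1 - 0)) :=
    (tendsto_natCast_rpow_neg (by linarith : -q < 0)).const_sub 1
  have hBt := tendsto_atTop_of_rpow hp hB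
  have h2 : Tendsto (fun n : ℕ => 1 / ((B n : ℝ) - 1)) atTop (𝓝 0) :=
    (tendsto_atTop_add_const_right atTop (-1) hBt).const_div_atTop 1
  have h3 := h1.mul (h2.const_add 1)
  simp only [sub_zero, add_zero, mul_one] at h3
  refine h3.congr' ?_
  filter_upwards [hBt.eventually_gt_atTop 1] with n hn
  have : (B n : ℝ) - 1 ≠ 0 := by linarith
  unfold oscWeight
  field_simp
  ring

lemma const_weight_eq {n : ℕ} (hn : 0 < n) (b : ℝ) :
    (n : ℝ) ^ (-q) * b = (n : ℝ) ^ (p - q) * (b / (n : ℝ) ^ p) := by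
  have hn' : (0 : ℝ) < n := by positivity
  have : (n : ℝ) ^ p ≠ 0 := by positivity
  rw [sub_eq_add_neg, Real.rpow_add hn']
  field_simp

lemma eventually_frequency_bounds (hp : 1 < p)
    (hB : ∀ n : ℕ, |(B n : ℝ) - (n : ℝ) ^ p| ≤ 1) :
    ∀ᶠ n : ℕ in atTop, (n : ℝ) ^ (p - 1) / 4 ≤ (((B n - 1) / 2 / n : ℕ) : ℝ) ∧
      (((B n - 1) / 2 / n : ℕ) : ℝ) ≤ (n : ℝ) ^ (p - 1) := by
  filter_upwards [eventually_rpow_bounds (by linarith : 0 < p) hB,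
    (tendsto_natCast_rpow (by linarith : 0 < p - 1)).eventually_ge_atTop 8,
    eventually_ge_atTop 1] with n h1 h2 hn
  have hn' : (1 : ℝ) ≤ n := by exact_mod_cast hn
  have hpow : (n : ℝ) ^ p = (n : ℝ) ^ (p - 1) * n := by
    rw [← Real.rpow_add_one (by positivity)]
    congr 1
    ring
  rw [Nat.div_div_eq_div_mul]
  set M := (B n - 1) / (2 * n) with hM
  have hlo : B n ≤ 2 * n * M + 2 * n := by
    have := Nat.lt_div_mul_add (a := B n - 1) (show 0 < 2 * n by omega)
    rw [← hM] at this
    have e : M * (2 * n) = 2 * n * M := by ring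
    omega
  have hhi : 2 * n * M ≤ B n := by
    have := Nat.mul_div_le (B n - 1) (2 * n)
    rw [← hM] at this
    omega
  have hlo' : (B n : ℝ) ≤ 2 * n * M + 2 * n := by exact_mod_cast hlo
  have hhi' : 2 * (n : ℝ) * M ≤ B n := by exact_mod_cast hhi
  have hb := abs_le.1 (hB n)
  rw [hpow] at h1 hb
  constructor
  · have h3 : (n : ℝ) * ((n : ℝ) ^ (p - 1) / 4) ≤ n * M := by nlinarith
    exact le_of_mul_le_mul_left h3 (by linarith)
  · have h3 : (n : ℝ) * M ≤ n * (n : ℝ) ^ (p - 1) := by linarith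
    exact le_of_mul_le_mul_left h3 (by linarith)

lemma tendsto_frequency (hp : 1 < p) (hB : ∀ n : ℕ, |(B n : ℝ) - (n : ℝ) ^ p| ≤ 1) :
    Tendsto (fun n : ℕ => (((B n - 1) / 2 / n : ℕ) : ℝ)) atTop atTop := by
  refine tendsto_atTop_mono' atTop ?_
    ((tendsto_natCast_rpow (by linarith : 0 < p - 1)).atTop_div_const (by norm_num : (0 : ℝ) < 4))
  filter_upwards [eventually_frequency_bounds hp hB] with n hn
  exact hn.1

/-- The constant feature carries a negligible part of the weight of the mean feature. -/
lemma eventually_const_weight_le (hp : 1 < p) (hq : 1 < q)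
    (hB : ∀ n : ℕ, |(B n : ℝ) - (n : ℝ) ^ p| ≤ 1) :
    ∀ᶠ n : ℕ in atTop, (n : ℝ) ^ (-q) * B n ≤ (((B n - 1) / 2 / n : ℕ) : ℝ) / 20 := by
  have h0 : ∀ᶠ n : ℕ in atTop, (n : ℝ) ^ (1 - q) < 1 / 160 :=
    (tendsto_natCast_rpow_neg (by linarith : 1 - q < 0)).eventually_lt_const (by norm_num)
  filter_upwards [h0, eventually_frequency_bounds hp hB,
    eventually_rpow_bounds (by linarith : 0 < p) hB, eventually_gt_atTop 0] with n h1 h2 h3 hn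
  have hn' : (0 : ℝ) < n := by positivity
  have e : (n : ℝ) ^ (p - q) = (n : ℝ) ^ (p - 1) * (n : ℝ) ^ (1 - q) := by
    rw [← Real.rpow_add hn']
    congr 1
    ring
  have hpos : 0 < (n : ℝ) ^ (p - 1) := by positivity
  rw [const_weight_eq (p := p) hn, e]
  have h4 : (B n : ℝ) / (n : ℝ) ^ p ≤ 2 := by
    rw [div_le_iff₀ (by positivity)]
    exact h3.2
  calc (n : ℝ) ^ (p - 1) * (n : ℝ) ^ (1 - q) * ((B n : ℝ) / (n : ℝ) ^ p)
      ≤ (n : ℝ) ^ (p - 1) * (1 / 160) * 2 := by gcongr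
    _ ≤ _ := by linarith [h2.1]

lemma eventually_oscWeight_bounds (hp : 0 < p) (hq : 0 < q)
    (hB : ∀ n : ℕ, |(B n : ℝ) - (n : ℝ) ^ p| ≤ 1) :
    ∀ᶠ n : ℕ in atTop, 1 / 2 ≤ oscWeight n (B n) q ∧ oscWeight n (B n) q ≤ 2 := by
  have h := tendsto_oscWeight hp hq hB
  filter_upwards [h.eventually_const_le (by norm_num : (1 / 2 : ℝ) < 1),
    h.eventually_le_const (by norm_num : (1 : ℝ) < 2)] with n h1 h2
  exact ⟨h1, h2⟩

lemma eventually_meanWeight_bounds (hp : 1 < p) (hq : 1 < q)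
    (hB : ∀ n : ℕ, |(B n : ℝ) - (n : ℝ) ^ p| ≤ 1) :
    ∀ᶠ n : ℕ in atTop, (n : ℝ) ^ (p - 1) / 8 ≤ meanWeight n (B n) q ∧
      meanWeight n (B n) q ≤ 3 * (n : ℝ) ^ (p - 1) := by
  filter_upwards [eventually_const_weight_le hp hq hB, eventually_frequency_bounds hp hB,
    eventually_oscWeight_bounds (by linarith : 0 < p) (by linarith : 0 < q) hB,
    eventually_gt_atTop 0] with n h1 h2 h3 hn
  have hn' : (0 : ℝ) < n := by positivity
  have h4 : 0 ≤ (n : ℝ) ^ (-q) * B n := by positivity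
  have hM : (0 : ℝ) ≤ (((B n - 1) / 2 / n : ℕ) : ℝ) := Nat.cast_nonneg _
  unfold meanWeight
  constructor
  · have h5 := mul_le_mul_of_nonneg_right h3.1 hM
    linarith [h2.1]
  · have h5 := mul_le_mul_of_nonneg_right h3.2 hM
    linarith [h2.2]

lemma eventually_two_le (hp : 0 < p) (hB : ∀ n : ℕ, |(B n : ℝ) - (n : ℝ) ^ p| ≤ 1) :
    ∀ᶠ n : ℕ in atTop, 2 ≤ B n := by
  filter_upwards [(tendsto_atTop_of_rpow hp hB).eventually_ge_atTop 2] with n hn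
  exact_mod_cast hn

lemma eventually_two_mul_le (hT : 1 < T) (hd : ∀ n : ℕ, |(d n : ℝ) - (n : ℝ) ^ T| ≤ 1) :
    ∀ᶠ n : ℕ in atTop, 2 * n ≤ d n := by
  filter_upwards [eventually_rpow_bounds (by linarith : 0 < T) hd, eventually_gt_atTop 0,
    (tendsto_natCast_rpow (by linarith : 0 < T - 1)).eventually_ge_atTop 4] with n h1 hn h2
  have hn' : (0 : ℝ) < n := by positivity
  have e : (n : ℝ) ^ T = (n : ℝ) ^ (T - 1) * n := by
    rw [← Real.rpow_add_one (by positivity)]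
    congr 1
    ring
  have h3 : (2 : ℝ) * n ≤ d n := by
    rw [e] at h1
    nlinarith [h1.1]
  exact_mod_cast h3

/-- The exponent of the pointwise concentration bound. -/
lemma eventually_exponent_le (hp : 1 < p) (hq : 1 < q) (hT : 1 < T)
    (hB : ∀ n : ℕ, |(B n : ℝ) - (n : ℝ) ^ p| ≤ 1)
    (hd : ∀ n : ℕ, |(d n : ℝ) - (n : ℝ) ^ T| ≤ 1) :
    ∀ᶠ n : ℕ in atTop, ∀ t : ℝ, t ^ 2 * (n : ℝ) ^ (T - 1) / 512
      ≤ t ^ 2 * (d n / 8 * meanWeight n (B n) q) / (2 * B n) := by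
  filter_upwards [eventually_rpow_bounds (by linarith : 0 < p) hB,
    eventually_rpow_bounds (by linarith : 0 < T) hd, eventually_meanWeight_bounds hp hq hB,
    eventually_gt_atTop 0, eventually_two_le (by linarith : 0 < p) hB] with n h1 h2 h3 hn h4 t
  have hn' : (0 : ℝ) < n := by positivity
  have hB0 : (0 : ℝ) < B n := by
    have : 0 < B n := by omega
    exact_mod_cast this
  rw [mul_div_assoc, mul_div_assoc]
  refine mul_le_mul_of_nonneg_left ?_ (sq_nonneg t)
  rw [le_div_iff₀ (by positivity)]
  -- `dκ/B` has order `n^T n^(p-1) / n^p = n^(T-1)`; the constant `512` collects the factors `2`,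
  -- `8` and `8` of the crude bounds.
  have e : (n : ℝ) ^ (T - 1) * (n : ℝ) ^ p = (n : ℝ) ^ T * (n : ℝ) ^ (p - 1) := by
    rw [← Real.rpow_add hn', ← Real.rpow_add hn']
    congr 1
    ring
  calc (n : ℝ) ^ (T - 1) / 512 * (2 * B n)
      ≤ (n : ℝ) ^ (T - 1) / 512 * (2 * (2 * (n : ℝ) ^ p)) := by gcongr; exact h1.2
    _ = ((n : ℝ) ^ T / 2) / 8 * ((n : ℝ) ^ (p - 1) / 8) := by linear_combination (1 / 128) * e
    _ ≤ _ := by gcongr; exacts [h2.1, h3.1]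

end Asymptotics

/-! ### Negative points of the Fourier fit in every period -/

section AdversarialPoints

variable {n B : ℕ} {q : ℝ}

/-- A point in the `k`-th period where the Fourier fit is negative. -/
noncomputable def negPoint (n M : ℕ) (k : ℤ) : ℝ :=
  -1 + (3 * Real.pi / (2 * M + 1) + k * (2 * Real.pi)) / (n * Real.pi)

/-- At `u = 3π/(2M+1)` the fast sine is `sin(3π/2) = -1`, while `sin(u/2) ≤ u/2`. So the kernel is
below `-(2M+1)/(3π)`, and `2/(3π) > 1/5`. -/
lemma cosSum_negPoint_le (hn : 0 < n) {M : ℕ} (hM : 0 < M) (k : ℤ) :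
    cosSum M (n * Real.pi * (negPoint n M k + 1)) ≤ -(M / 5) := by
  have hn' : (n : ℝ) ≠ 0 := by positivity
  have hpi := Real.pi_pos
  have hM' : (1 : ℝ) ≤ M := by exact_mod_cast hM
  set u := 3 * Real.pi / (2 * M + 1) with hu
  have e : (n : ℝ) * Real.pi * (negPoint n M k + 1) = u + k * (2 * Real.pi) := by
    rw [negPoint, ← hu]
    field_simp
    ring
  rw [e, (cosSum_periodic M).int_mul k u]
  have hN : (0 : ℝ) < 2 * M + 1 := by linarith
  have hu0 : 0 < u := by positivity
  have huN : u * (2 * M + 1) = 3 * Real.pi := by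
    rw [hu]
    field_simp
  have hu1 : u ≤ Real.pi := by nlinarith
  have hD := cosSum_mul_sin M u
  have h1 : (2 * (M : ℝ) + 1) * (u / 2) = Real.pi / 2 + Real.pi := by linarith
  rw [h1, Real.sin_add_pi, Real.sin_pi_div_two] at hD
  have hs0 : 0 < Real.sin (u / 2) := Real.sin_pos_of_pos_of_lt_pi (by linarith) (by linarith)
  have hs1 : Real.sin (u / 2) ≤ u / 2 := Real.sin_le (by linarith)
  by_contra! hcon
  have h2 : 2 * Real.sin (u / 2) * -(M / 5 : ℝ) < 2 * Real.sin (u / 2) * cosSum M u :=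
    mul_lt_mul_of_pos_left hcon (by linarith)
  have h3 : Real.sin (u / 2) * M ≤ u / 2 * M := mul_le_mul_of_nonneg_right hs1 (by linarith)
  have hpi4 := Real.pi_lt_d2
  nlinarith

/-- Consecutive points are `2/n` apart, so rounding leaves an error of at most `1/n`. Near the ends
the nearest point may fall outside `[-1, 1]`, which the adversary is allowed to use; hence `k`
starts at `-1`. -/
lemma exists_negPoint_near (hn : 0 < n) {M : ℕ} (hM : 0 < M) {x : ℝ}
    (hx : x ∈ Set.Icc (-1 : ℝ) 1) :
    ∃ k ∈ Finset.Icc (-1 : ℤ) n, |negPoint n M k - x| ≤ 1 / n := by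
  have hn' : (0 : ℝ) < n := by positivity
  have hpi := Real.pi_pos
  have hM' : (1 : ℝ) ≤ M := by exact_mod_cast hM
  set u := 3 * Real.pi / (2 * M + 1) with hu
  have hN : (0 : ℝ) < 2 * M + 1 := by linarith
  have hu0 : 0 < u := by positivity
  have huN : u * (2 * M + 1) = 3 * Real.pi := by
    rw [hu]
    field_simp
  have hu1 : u ≤ Real.pi := by nlinarith
  set y := (n * Real.pi * (x + 1) - u) / (2 * Real.pi) with hy
  have hround := abs_le.1 (abs_sub_round y)
  have hy1 : y ≤ n := by
    rw [hy, div_le_iff₀ (by positivity)]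
    nlinarith [hx.2, mul_pos hn' hpi]
  have hy0 : -(1 / 2) ≤ y := by
    rw [hy, le_div_iff₀ (by positivity)]
    have : 0 ≤ n * Real.pi * (x + 1) := mul_nonneg (by positivity) (by linarith [hx.1])
    linarith
  refine ⟨round y, Finset.mem_Icc.2 ⟨?_, ?_⟩, ?_⟩
  · have : (-1 : ℝ) ≤ round y := by linarith
    exact_mod_cast this
  · have : (round y : ℝ) < n + 1 := by linarith
    have : round y < n + 1 := by exact_mod_cast this
    omega
  · have e : negPoint n M (round y) - x = 2 * (round y - y) / n := by
      rw [hy, negPoint, ← hu]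
      field_simp
      ring
    rw [e, abs_div, abs_of_pos hn', abs_mul, abs_of_pos (two_pos : (0 : ℝ) < 2), abs_sub_comm]
    have := abs_sub_round y
    gcongr
    linarith

lemma fourierFit_negPoint_le (hn : 2 ≤ n) (hB : 2 ≤ B) (hq : 0 < q)
    (hM : 0 < (B - 1) / 2 / n) (hc : 1 / 2 ≤ oscWeight n B q)
    (hw : (n : ℝ) ^ (-q) * B ≤ (((B - 1) / 2 / n : ℕ) : ℝ) / 20) (k : ℤ) :
    fourierFit n B q (negPoint n ((B - 1) / 2 / n) k) ≤ -(1 / 10) := by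
  rw [fourierFit_eq hn hB hq, div_le_iff₀ (meanWeight_pos hn hB hq), meanWeight]
  have h1 := cosSum_negPoint_le (show 0 < n by omega) hM k
  have h2 := mul_le_mul_of_nonneg_left h1 (show 0 ≤ oscWeight n B q by linarith)
  have hM' : (0 : ℝ) ≤ (((B - 1) / 2 / n : ℕ) : ℝ) := Nat.cast_nonneg _
  have h3 := mul_le_mul_of_nonneg_right hc hM'
  linarith

end AdversarialPoints

/-! ### Borel–Cantelli and the almost sure limits -/

section BorelCantelli

/-- Borel–Cantelli for events described by random variables with known laws. -/
lemma ae_eventually_notMem_of_hasLaw {Ω : Type*} [MeasurableSpace Ω] {P : Measure Ω}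
    [IsProbabilityMeasure P] {α : ℕ → Type*} [∀ n, MeasurableSpace (α n)]
    {μ : ∀ n, Measure (α n)} [∀ n, IsProbabilityMeasure (μ n)] {X : ∀ n, Ω → α n}
    (hX : ∀ n, HasLaw (X n) (μ n) P) {A : ∀ n, Set (α n)} {ρ : ℕ → ℝ} (hρ : Summable ρ)
    (hA : ∀ᶠ n in atTop, (μ n).real (A n) ≤ ρ n) :
    ∀ᵐ ω ∂P, ∀ᶠ n in atTop, X n ω ∉ A n := by
  -- This inequality holds for every set, so the events need not be measurable.
  have hle : ∀ n, P (X n ⁻¹' A n) ≤ μ n (A n) := fun n => by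
    rw [← (hX n).map_eq]
    exact Measure.le_map_apply (hX n).aemeasurable _
  have hsum : Summable fun n => (μ n).real (A n) := by
    refine Summable.of_norm_bounded_eventually_nat hρ ?_
    filter_upwards [hA] with n hn
    rwa [Real.norm_of_nonneg measureReal_nonneg]
  have hfin : ∑' n, P (X n ⁻¹' A n) ≠ ⊤ := by
    refine ne_top_of_le_ne_top hsum.tsum_ofReal_ne_top (ENNReal.tsum_le_tsum fun n => ?_)
    rw [Measure.real, ENNReal.ofReal_toReal (measure_ne_top _ _)]
    exact hle n
  exact ae_eventually_notMem hfin

end BorelCantelli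

section Limits

variable {p q T : ℝ} {B d : ℕ → ℕ}

lemma eventually_existsUnique_fourier (hp : 1 < p) (hq : 1 < q)
    (hB : ∀ n : ℕ, |(B n : ℝ) - (n : ℝ) ^ p| ≤ 1) :
    ∀ᶠ n in atTop, ∃! α : EuclideanSpace ℝ (Fin (B n)),
      IsMinInterpolator n (fourierFeature (B n)) (weightedNorm n (B n) q) α := by
  filter_upwards [eventually_two_le (by linarith : 0 < p) hB, eventually_ge_atTop 2] with n h1 hn
  exact (fourier_interpolation (bilevelWeight_pos hn h1 (by linarith))
    (meanWeight_pos hn h1 (by linarith)).ne'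
    (mean_bilevelSigma_trainPoint (by omega) (by omega) q)).1

/-- Sublevel probabilities of the Fourier fit at negligible levels have a common limit. -/
lemma exists_tendsto_unif_fourierFit_le (hp : 1 < p) (hq : 1 < q)
    (hB : ∀ n : ℕ, |(B n : ℝ) - (n : ℝ) ^ p| ≤ 1) :
    ∃ L : ℝ, ∀ τ : ℕ → ℝ, Tendsto (fun n => τ n * meanWeight n (B n) q) atTop (𝓝 0) →
      Tendsto (fun n => unif.real {x | fourierFit n (B n) q x ≤ τ n}) atTop (𝓝 L) := by
  have hc := tendsto_oscWeight (by linarith : 0 < p) (by linarith : 0 < q) hB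
  have hN : Tendsto (fun n : ℕ => 2 * (((B n - 1) / 2 / n : ℕ) : ℝ) + 1) atTop atTop :=
    tendsto_atTop_add_const_right _ _ ((tendsto_frequency hp hB).const_mul_atTop (by norm_num))
  have hratio := tendsto_div_rpow (by linarith : 0 < p) hB
  have hl : (fun n : ℕ => (n : ℝ) ^ (p - q) * ((B n : ℝ) / (n : ℝ) ^ p))
      =ᶠ[atTop] fun n : ℕ => (n : ℝ) ^ (-q) * B n := by
    filter_upwards [eventually_gt_atTop 0] with n hn
    exact (const_weight_eq hn _).symm
  suffices h : ∃ L : ℝ, ∀ τ : ℕ → ℝ, Tendsto (fun n => τ n * meanWeight n (B n) q) atTop (𝓝 0) →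
      Tendsto (fun n : ℕ => sineRatioLevel (2 * (((B n - 1) / 2 / n : ℕ) : ℝ) + 1)
        (1 - ((n : ℝ) ^ (-q) * B n - 2 * (τ n * meanWeight n (B n) q)) / oscWeight n (B n) q))
        atTop (𝓝 L) by
    obtain ⟨L, hL⟩ := h
    refine ⟨1 / Real.pi * L, fun τ hτ => ((hL τ hτ).const_mul (1 / Real.pi)).congr' ?_⟩
    filter_upwards [eventually_two_le (by linarith : 0 < p) hB, eventually_ge_atTop 2] with n h1 hn
    exact (unif_fourierFit_le hn h1 (by linarith) (τ n)).symm
  have hfin : ∀ l : ℝ, Tendsto (fun n : ℕ => (n : ℝ) ^ (-q) * B n) atTop (𝓝 l) →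
      ∀ τ : ℕ → ℝ, Tendsto (fun n => τ n * meanWeight n (B n) q) atTop (𝓝 0) →
      Tendsto (fun n : ℕ => sineRatioLevel (2 * (((B n - 1) / 2 / n : ℕ) : ℝ) + 1)
        (1 - ((n : ℝ) ^ (-q) * B n - 2 * (τ n * meanWeight n (B n) q)) / oscWeight n (B n) q))
        atTop (𝓝 (averagedLevel (1 - (l - 2 * 0) / 1) 0 / (2 * Real.pi))) := by
    intro l hl τ hτ
    exact tendsto_sineRatioLevel hN
      (((hl.sub (hτ.const_mul 2)).div hc one_ne_zero).const_sub 1)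
  -- The constant weight `n^(-q) B` tends to `0`, `1` or infinity, so the slope `b` tends to `1`,
  -- `0` or `-∞`.
  rcases lt_trichotomy p q with hpq | hpq | hpq
  · refine ⟨_, hfin 0 ?_⟩
    have := (tendsto_natCast_rpow_neg (by linarith : p - q < 0)).mul hratio
    rw [zero_mul] at this
    exact this.congr' hl
  · refine ⟨_, hfin 1 ?_⟩
    refine hratio.congr' (EventuallyEq.trans ?_ hl)
    exact Eventually.of_forall fun n => by simp [hpq]
  · refine ⟨0, fun τ hτ => tendsto_sineRatioLevel_atBot ?_⟩
    have h1 : Tendsto (fun n : ℕ => (n : ℝ) ^ (-q) * B n) atTop atTop :=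
      ((tendsto_natCast_rpow (by linarith : 0 < p - q)).atTop_mul_pos one_pos hratio).congr' hl
    have h2 := h1.atTop_add ((hτ.const_mul 2).neg)
    have h3 := (h2.atTop_mul_pos (by norm_num : (0 : ℝ) < 1⁻¹) (hc.inv₀ one_ne_zero))
    have h4 := tendsto_atBot_add_const_left atTop (1 : ℝ) (tendsto_neg_atTop_atBot.comp h3)
    refine h4.congr fun n => ?_
    simp only [Function.comp]
    ring

variable {Ω : Type*} [MeasurableSpace Ω] {P : Measure Ω} [IsProbabilityMeasure P]
  {X : ∀ n, Ω → Fin (d n) → EuclideanSpace ℝ (Fin (B n))}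

lemma ae_eventually_lt_norm_meanResidual (hp : 1 < p) (hq : 1 < q) (hT : 1 < T)
    (hB : ∀ n : ℕ, |(B n : ℝ) - (n : ℝ) ^ p| ≤ 1)
    (hd : ∀ n : ℕ, |(d n : ℝ) - (n : ℝ) ^ T| ≤ 1)
    (hX : ∀ n, HasLaw (X n) (gaussianRows (d n) (bilevelSigma n (B n) q)) P) :
    ∀ᵐ ω ∂P, ∀ᶠ n in atTop,
      d n / 8 * meanWeight n (B n) q < ‖meanResidual n (X n ω)‖ ^ 2 := by
  have h := ae_eventually_notMem_of_hasLaw hX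
    (A := fun n => {z | ‖meanResidual n z‖ ^ 2 ≤ d n / 8 * meanWeight n (B n) q})
    (summable_pow_mul_exp_neg_rpow 0 (by norm_num : (0 : ℝ) < 1 / 32) (by linarith : 0 < T)) ?_
  · filter_upwards [h] with ω hω
    filter_upwards [hω] with n hn
    exact not_le.1 hn
  · filter_upwards [eventually_two_le (by linarith : 0 < p) hB, eventually_ge_atTop 2,
      eventually_two_mul_le hT hd, eventually_rpow_bounds (by linarith : 0 < T) hd]
      with n h1 hn h2 h3
    refine (prob_meanResidual_le (bilevelWeight_pos hn h1 (by linarith))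
      (meanWeight_pos hn h1 (by linarith)) (mean_bilevelSigma_trainPoint (by omega) (by omega) q)
      (by omega) h2).trans ?_
    rw [pow_zero, one_mul]
    refine Real.exp_le_exp.2 ?_
    linarith [h3.1]

/-- With enough random features the two fits agree up to `n ^ (-p)` at most points. -/
lemma ae_eventually_unif_fit_sub_fit_lt (hp : 1 < p) (hq : 1 < q) (hT : 2 * p + 1 < T)
    (hB : ∀ n : ℕ, |(B n : ℝ) - (n : ℝ) ^ p| ≤ 1)
    (hd : ∀ n : ℕ, |(d n : ℝ) - (n : ℝ) ^ T| ≤ 1)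
    (hX : ∀ n, HasLaw (X n) (gaussianRows (d n) (bilevelSigma n (B n) q)) P) :
    ∀ᵐ ω ∂P, ∀ᶠ n : ℕ in atTop, unif.real {x | (n : ℝ) ^ (-p)
      < |rfsFit n (X n ω) x - fourierFit n (B n) q x|} < 1 / n := by
  have h := ae_eventually_notMem_of_hasLaw hX
    (A := fun n => {z | d n / 8 * meanWeight n (B n) q < ‖meanResidual n z‖ ^ 2 ∧
      1 / (n : ℝ) ≤ unif.real {x | (n : ℝ) ^ (-p) < |rfsFit n z x - fourierFit n (B n) q x|}})
    ((summable_pow_mul_exp_neg_rpow 1 (by norm_num : (0 : ℝ) < 1 / 512)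
      (by linarith : 0 < T - 1 - 2 * p)).mul_left 2) ?_
  · filter_upwards [h, ae_eventually_lt_norm_meanResidual hp hq (by linarith : 1 < T) hB hd hX]
      with ω hω hω2
    filter_upwards [hω, hω2] with n hn hn2
    by_contra hcon
    exact hn ⟨hn2, not_lt.1 hcon⟩
  · filter_upwards [eventually_two_le (by linarith : 0 < p) hB, eventually_ge_atTop 2,
      eventually_two_mul_le (by linarith : 1 < T) hd,
      eventually_exponent_le hp hq (by linarith : 1 < T) hB hd] with n h1 hn h2 h3
    have hn' : (0 : ℝ) < n := by positivity
    have hB0 : (0 : ℝ) < B n := by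
      have : 0 < B n := by omega
      exact_mod_cast this
    refine (prob_le_unif_fit_sub_fit (bilevelWeight_pos hn h1 (by linarith))
      (meanWeight_pos hn h1 (by linarith)) (mean_bilevelSigma_trainPoint (by omega) (by omega) q)
      (by omega) (by omega) hB0 (feature_bilevelSigma_feature_le hn h1 (by linarith))
      (by positivity : (0 : ℝ) ≤ (n : ℝ) ^ (-p)) (by positivity)).trans ?_
    -- A positive power of `n` is left exactly when `T > 2p + 1`, which makes the bounds summable.
    have e : ((n : ℝ) ^ (-p)) ^ 2 * (n : ℝ) ^ (T - 1) = (n : ℝ) ^ (T - 1 - 2 * p) := by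
      rw [← Real.rpow_natCast, ← Real.rpow_mul hn'.le, ← Real.rpow_add hn']
      congr 1
      push_cast
      ring
    have h4 := h3 ((n : ℝ) ^ (-p))
    rw [e] at h4
    rw [div_div_eq_mul_div, div_one, pow_one, mul_assoc, mul_comm (Real.exp _)]
    have h5 : Real.exp (-(((n : ℝ) ^ (-p)) ^ 2 * (d n / 8 * meanWeight n (B n) q) / (2 * B n)))
        ≤ Real.exp (-(1 / 512 * (n : ℝ) ^ (T - 1 - 2 * p))) := by
      refine Real.exp_le_exp.2 ?_
      linarith
    gcongr

/-- The random fit is negative at the points where the Fourier fit is most negative. -/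
lemma ae_eventually_rfsFit_negPoint_le (hp : 1 < p) (hq : 1 < q) (hT : 1 < T)
    (hB : ∀ n : ℕ, |(B n : ℝ) - (n : ℝ) ^ p| ≤ 1)
    (hd : ∀ n : ℕ, |(d n : ℝ) - (n : ℝ) ^ T| ≤ 1)
    (hX : ∀ n, HasLaw (X n) (gaussianRows (d n) (bilevelSigma n (B n) q)) P) :
    ∀ᵐ ω ∂P, ∀ᶠ n : ℕ in atTop, ∀ k ∈ Finset.Icc (-1 : ℤ) n,
      |rfsFit n (X n ω) (negPoint n ((B n - 1) / 2 / n) k)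
        - fourierFit n (B n) q (negPoint n ((B n - 1) / 2 / n) k)| ≤ 1 / 10 := by
  have h := ae_eventually_notMem_of_hasLaw hX
    (A := fun n => ⋃ k ∈ Finset.Icc (-1 : ℤ) n,
      {z | d n / 8 * meanWeight n (B n) q < ‖meanResidual n z‖ ^ 2 ∧
        1 / 10 < |rfsFit n z (negPoint n ((B n - 1) / 2 / n) k)
          - fourierFit n (B n) q (negPoint n ((B n - 1) / 2 / n) k)|})
    -- `51200 = 512 · 10²` comes from the deviation `1/10`; the prefactor `4n` bounds `2(n + 2)` for
    -- `n ≥ 2`.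
    ((summable_pow_mul_exp_neg_rpow 1 (by norm_num : (0 : ℝ) < 1 / 51200)
      (by linarith : 0 < T - 1)).mul_left 4) ?_
  · filter_upwards [h, ae_eventually_lt_norm_meanResidual hp hq hT hB hd hX] with ω hω hω2
    filter_upwards [hω, hω2] with n hn hn2 k hk
    by_contra hcon
    exact hn (Set.mem_iUnion₂.2 ⟨k, hk, hn2, not_le.1 hcon⟩)
  · filter_upwards [eventually_two_le (by linarith : 0 < p) hB, eventually_ge_atTop 2,
      eventually_two_mul_le hT hd, eventually_exponent_le hp hq hT hB hd] with n h1 hn h2 h3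
    have hn' : (2 : ℝ) ≤ n := by exact_mod_cast hn
    have hB0 : (0 : ℝ) < B n := by
      have : 0 < B n := by omega
      exact_mod_cast this
    have hcard : ((Finset.Icc (-1 : ℤ) n).card : ℝ) = n + 2 := by
      rw [Int.card_Icc]
      have : ((n : ℤ) + 1 - -1).toNat = n + 2 := by omega
      rw [this]
      push_cast
      ring
    have hpt : ∀ k ∈ Finset.Icc (-1 : ℤ) n, (gaussianRows (d n) (bilevelSigma n (B n) q)).real
        {z | d n / 8 * meanWeight n (B n) q < ‖meanResidual n z‖ ^ 2 ∧
          1 / 10 < |rfsFit n z (negPoint n ((B n - 1) / 2 / n) k)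
            - fourierFit n (B n) q (negPoint n ((B n - 1) / 2 / n) k)|}
        ≤ 2 * Real.exp (-(1 / 51200 * (n : ℝ) ^ (T - 1))) := by
      intro k _
      refine (prob_lt_abs_fit_sub_fit (bilevelWeight_pos hn h1 (by linarith))
        (meanWeight_pos hn h1 (by linarith)) (mean_bilevelSigma_trainPoint (by omega) (by omega) q)
        (by omega) (by omega) hB0 _ (feature_bilevelSigma_feature_le hn h1 (by linarith) _)
        (by norm_num : (0 : ℝ) ≤ 1 / 10)).trans ?_
      have h4 := h3 (1 / 10)
      have h5 : Real.exp (-((1 / 10 : ℝ) ^ 2 * (d n / 8 * meanWeight n (B n) q) / (2 * B n)))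
          ≤ Real.exp (-(1 / 51200 * (n : ℝ) ^ (T - 1))) := by
        refine Real.exp_le_exp.2 ?_
        linarith
      gcongr
    refine (measureReal_biUnion_finset_le _ _).trans ((Finset.sum_le_sum hpt).trans ?_)
    rw [Finset.sum_const, nsmul_eq_mul, hcard, pow_one]
    have hexp := Real.exp_pos (-(1 / 51200 * (n : ℝ) ^ (T - 1)))
    nlinarith

end Limits

end RFS

theorem theorem2 (p q T : ℝ) (hp : 1 < p) (hq : 1 < q) (hT : 1 < T)
    (B d : ℕ → ℕ)
    (hB : ∀ n : ℕ, |(B n : ℝ) - (n : ℝ) ^ p| ≤ 1)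
    (hd : ∀ n : ℕ, |(d n : ℝ) - (n : ℝ) ^ T| ≤ 1)
    {Ω : Type*} [MeasurableSpace Ω] (P : Measure Ω) [IsProbabilityMeasure P]
    (Z : (n : ℕ) → Fin (d n) → Ω → EuclideanSpace ℝ (Fin (B n)))
    (hZlaw : ∀ (n : ℕ) (i : Fin (d n)),
      HasLaw (Z n i) (multivariateGaussian 0 (RFS.bilevelSigma n (B n) q)) P)
    (hZindep : ∀ n : ℕ, iIndepFun (Z n) P) :
    (∀ᶠ n in atTop, ∃! α : EuclideanSpace ℝ (Fin (B n)),
        RFS.IsMinInterpolator n (RFS.fourierFeature (B n))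
          (RFS.weightedNorm n (B n) q) α) ∧
    (∀ᵐ ω ∂P, ∀ᶠ n in atTop, ∃! β : EuclideanSpace ℝ (Fin (d n)),
        RFS.IsMinInterpolator n (RFS.rfsFeature fun i => Z n i ω) (fun b => ‖b‖) β) ∧
    (6 * p - 1 < T →
      ∃ L : ℝ,
        Tendsto (fun n : ℕ => RFS.classRisk (RFS.fourierFit n (B n) q)) atTop (𝓝 L) ∧
        ∀ᵐ ω ∂P, Tendsto (fun n : ℕ => RFS.classRisk (RFS.rfsFit n fun i => Z n i ω))
          atTop (𝓝 L)) ∧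
    (6 * p + 1 - 2 * q < T →
      ∃ L : ℝ,
        Tendsto (fun n : ℕ => RFS.advRisk (RFS.fourierFit n (B n) q) (1 / (n : ℝ)))
          atTop (𝓝 L) ∧
        ∀ᵐ ω ∂P, Tendsto
          (fun n : ℕ => RFS.advRisk (RFS.rfsFit n fun i => Z n i ω) (1 / (n : ℝ)))
          atTop (𝓝 L)) := by
  have hX : ∀ n, HasLaw (fun ω i => Z n i ω)
      (RFS.gaussianRows (d n) (RFS.bilevelSigma n (B n) q)) P :=
    fun n => (hZindep n).hasLaw_pi (hZlaw n)
  refine ⟨RFS.eventually_existsUnique_fourier hp hq hB, ?_, fun hT1 => ?_, fun _ => ?_⟩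
  · filter_upwards [RFS.ae_eventually_lt_norm_meanResidual hp hq hT hB hd hX] with ω hω
    filter_upwards [hω, RFS.eventually_two_le (by linarith : 0 < p) hB, eventually_ge_atTop 2]
      with n h1 h2 hn
    refine (RFS.rfs_interpolation (by omega) _ fun h0 => ?_).1
    have h3 := RFS.meanWeight_pos hn h2 (by linarith : 0 < q)
    rw [h0, norm_zero] at h1
    have h4 : 0 ≤ d n / 8 * RFS.meanWeight n (B n) q := by positivity
    norm_num at h1
    linarith
  · obtain ⟨L, hL⟩ := RFS.exists_tendsto_unif_fourierFit_le hp hq hB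
    -- The product is of order `n^(-p) n^(p-1) = 1/n`, so the level `n^(-p)` does not affect the
    -- limit.
    have hτ : Tendsto (fun n : ℕ => (n : ℝ) ^ (-p) * RFS.meanWeight n (B n) q) atTop (𝓝 0) := by
      have h0 := (RFS.tendsto_natCast_rpow_neg (by norm_num : (-1 : ℝ) < 0)).const_mul 3
      rw [mul_zero] at h0
      refine squeeze_zero' ?_ ?_ h0
      · filter_upwards [RFS.eventually_two_le (by linarith : 0 < p) hB, eventually_ge_atTop 2]
          with n h2 hn
        have := RFS.meanWeight_pos hn h2 (by linarith : 0 < q)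
        positivity
      · filter_upwards [RFS.eventually_meanWeight_bounds hp hq hB, eventually_gt_atTop 0]
          with n h1 hn
        have hn' : (0 : ℝ) < n := by positivity
        calc (n : ℝ) ^ (-p) * RFS.meanWeight n (B n) q
            ≤ (n : ℝ) ^ (-p) * (3 * (n : ℝ) ^ (p - 1)) := by gcongr; exact h1.2
          _ = 3 * (n : ℝ) ^ (-1 : ℝ) := by
              rw [mul_left_comm, ← Real.rpow_add hn']
              congr 2
              ring
    have hinv : Tendsto (fun n : ℕ => 1 / (n : ℝ)) atTop (𝓝 0) :=
      tendsto_one_div_atTop_nhds_zero_nat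
    refine ⟨L, ?_, ?_⟩
    · simp_rw [RFS.classRisk_eq]
      exact hL (fun _ => 0) (by simp)
    -- `6p - 1 > 2p + 1` because `p > 1`.
    · filter_upwards [RFS.ae_eventually_unif_fit_sub_fit_lt hp hq (by linarith : 2 * p + 1 < T)
        hB hd hX] with ω hω
      have hup := (hL _ hτ).add hinv
      have hlo := (hL (fun n => -(n : ℝ) ^ (-p)) (by simpa using hτ.neg)).sub hinv
      rw [add_zero] at hup
      rw [sub_zero] at hlo
      refine tendsto_of_tendsto_of_tendsto_of_le_of_le' hlo hup ?_ ?_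
      · filter_upwards [hω] with n hn
        have := (RFS.classRisk_bounds (RFS.fourierFit n (B n) q) (RFS.rfsFit n fun i => Z n i ω)
          ((n : ℝ) ^ (-p))).2
        linarith
      · filter_upwards [hω] with n hn
        have := (RFS.classRisk_bounds (RFS.fourierFit n (B n) q) (RFS.rfsFit n fun i => Z n i ω)
          ((n : ℝ) ^ (-p))).1
        linarith
  · have hneg : ∀ᶠ n : ℕ in atTop, 0 < n ∧ 0 < (B n - 1) / 2 / n ∧
        ∀ k, RFS.fourierFit n (B n) q (RFS.negPoint n ((B n - 1) / 2 / n) k) ≤ -(1 / 10) := by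
      filter_upwards [RFS.eventually_two_le (by linarith : 0 < p) hB, eventually_ge_atTop 2,
        (RFS.tendsto_frequency hp hB).eventually_gt_atTop 0,
        RFS.eventually_oscWeight_bounds (by linarith : 0 < p) (by linarith : 0 < q) hB,
        RFS.eventually_const_weight_le hp hq hB] with n h1 hn h2 h3 h4
      have hM : 0 < (B n - 1) / 2 / n := by exact_mod_cast h2
      exact ⟨by omega, hM, RFS.fourierFit_negPoint_le hn h1 (by linarith) hM h3.1 h4⟩
    -- Eventually each adversarial risk equals `1`, so the sequences are eventually constant.
    refine ⟨1, ?_, ?_⟩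
    · refine tendsto_const_nhds.congr' ?_
      filter_upwards [hneg] with n hn
      refine (RFS.advRisk_eq_one fun x hx => ?_).symm
      obtain ⟨k, -, hk⟩ := RFS.exists_negPoint_near hn.1 hn.2.1 hx
      exact ⟨_, hk, by linarith [hn.2.2 k]⟩
    · filter_upwards [RFS.ae_eventually_rfsFit_negPoint_le hp hq hT hB hd hX] with ω hω
      refine tendsto_const_nhds.congr' ?_
      filter_upwards [hneg, hω] with n hn hn2
      refine (RFS.advRisk_eq_one fun x hx => ?_).symm
      obtain ⟨k, hk1, hk⟩ := RFS.exists_negPoint_near hn.1 hn.2.1 hx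
      exact ⟨_, hk, by linarith [hn.2.2 k, (abs_le.1 (hn2 k hk1)).2]⟩
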